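/- Let $M$ be the Möbius band, i.e. the quotient of the square $[0,1]\times[0,1]$ by the identification $(0,t)\sim(1,1-t)$, and let its central circle be the image of $[0,1]\times\{1/2\}$ in $M$. A continuous map is a *weak homotopy equivalence* if it induces a bijection on $\pi_0$ and isomorphisms on $\pi_n$ for all $n\ge 1$ and all base points; two spaces are *weakly homotopy equivalent* if they are joined by a finite zigzag of such maps. A *finite model* of a space $X$ is a finite topological space weakly homotopy equivalent to $X$, and a *minimal finite model* of $X$ is a finite model of least cardinality. The *pseudocircle* is the four-point space $\{a,b,c,d\}$ whose minimal open neighbourhoods of $a,b,c,d$ are $\{a\}$, $\{b\}$, $\{a,b,c\}$, $\{a,b,d\}$ respectively. 1. $M$ deformation retracts onto its central circle (through a homotopy fixing the central circle pointwise), which is homeomorphic to $S^1$; hence $M$ is homotopy equivalent to $S^1$. 2. Therefore $\pi_1(M)\cong\pi_1(S^1)\cong\mathbb{Z}$ and $\pi_n(M)=0$ for all $n\ge 2$ (at every base point), and in integral singular homology $H_n(M)\cong H_n(S^1)$ for all $n \ge 0$, where $H_n(S^1)\cong\mathbb{Z}$ for $n=0,1$ and $H_n(S^1)=0$ for $n\ge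 2$. 3. $M$ and $S^1$ have the same minimal finite models: a topological space is a minimal finite model of $M$ if and only if it is a minimal finite model of $S^1$, and this holds if and only if it is homeomorphic to the four-point pseudocircle. -/

import Mathlib

open scoped unitInterval Topology Topology.Homotopy

/-! ### Induced maps on homotopy groups, weak homotopy equivalences -/

section Weak

universe u

variable {X Y : Type u} [TopologicalSpace X] [TopologicalSpace Y]

/-- The map `π₀(X) → π₀(Y)` on path components induced by a continuous map. -/
def inducedPiZero (f : C(X, Y)) : ZerothHomotopy X → ZerothHomotopy Y :=
  Quotient.map f fun _ _ h => h.map f.continuous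

/-- Composition of a based `n`-cube loop with a continuous map. -/
def genLoopMap (f : C(X, Y)) (n : ℕ) (x : X) (p : Ω^ (Fin n) X x) : Ω^ (Fin n) Y (f x) :=
  ⟨f.comp p.1, fun y hy => congrArg f (p.2 y hy)⟩

/-- The map `πₙ(X, x) → πₙ(Y, f x)` induced by a continuous map `f`. -/
def inducedPi (f : C(X, Y)) (n : ℕ) (x : X) : π_ n X x → π_ n Y (f x) :=
  Quotient.map (genLoopMap f n x) fun _ _ h => h.map fun H => H.compContinuousMap f

/-- For positive degrees the induced map is a group homomorphism
`πₙ₊₁(X, x) → πₙ₊₁(Y, f x)`. -/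
noncomputable def inducedPiHom (f : C(X, Y)) (n : ℕ) (x : X) : π_ (n + 1) X x →* π_ (n + 1) Y (f x) :=
  MonoidHom.mk' (inducedPi f (n + 1) x) (by
    rintro ⟨p⟩ ⟨q⟩
    refine (congrArg (inducedPi f (n + 1) x)
      (HomotopyGroup.mul_spec (i := 0) (p := p) (q := q))).trans ?_
    refine Eq.trans ?_ (HomotopyGroup.mul_spec (i := 0) (p := genLoopMap f (n + 1) x p)
      (q := genLoopMap f (n + 1) x q)).symm
    refine congrArg (fun g : Ω^ (Fin (n + 1)) Y (f x) =>
      (Quotient.mk (GenLoop.Homotopic.setoid _ _) g : π_ (n + 1) Y (f x))) ?_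
    ext t
    simp only [genLoopMap, GenLoop.transAt, GenLoop.coe_copy, GenLoop.mk_apply,
      ContinuousMap.comp_apply]
    change f (ite _ _ _) = _
    split_ifs <;> rfl)

/-- `f` is a weak homotopy equivalence: it induces a bijection on path components and
isomorphisms on all homotopy groups of positive degree, at every base point. -/
def IsWeakHomotopyEquivalence (f : C(X, Y)) : Prop :=
  Function.Bijective (inducedPiZero f) ∧
    ∀ (n : ℕ) (x : X), Function.Bijective (inducedPiHom f n x)

/-- Two spaces are weakly homotopy equivalent if they are joined by a finite zigzag of weak
homotopy equivalences (the equivalence relation generated by the existence of such a map). -/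
def WeaklyHomotopyEquivalent (X Y : Type u) [TopologicalSpace X] [TopologicalSpace Y] : Prop :=
  Relation.EqvGen
    (fun A B : TopCat.{u} => ∃ f : C(A, B), IsWeakHomotopyEquivalence f)
    (TopCat.of X) (TopCat.of Y)

/-- `Y` is a finite model of `X`: a finite space weakly homotopy equivalent to `X`. -/
def IsFiniteModel (Y X : Type u) [TopologicalSpace Y] [TopologicalSpace X] : Prop :=
  Finite Y ∧ WeaklyHomotopyEquivalent Y X

/-- `Y` is a minimal finite model of `X`: a finite model of least cardinality. -/
def IsMinimalFiniteModel (Y X : Type u) [TopologicalSpace Y] [TopologicalSpace X] : Prop :=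
  IsFiniteModel Y X ∧
    ∀ (Z : Type u) [TopologicalSpace Z], IsFiniteModel Z X → Nat.card Y ≤ Nat.card Z

/-- `X` deformation retracts onto `A`: the identity of `X` is homotopic, through maps that fix
every point of `A`, to a map with values in `A`. -/
def DeformationRetractsOnto (X : Type u) [TopologicalSpace X] (A : Set X) : Prop :=
  ∃ r : C(X, X), (∀ x, r x ∈ A) ∧ (ContinuousMap.id X).HomotopicRel r A

end Weak

/-! ### The Möbius band -/

/-- The gluing `(0, t) ∼ (1, 1 - t)` of the left and right edges of the unit square. -/
def MobiusGlue (p q : I × I) : Prop :=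
  ∃ t : I, p = (0, t) ∧ q = (1, unitInterval.symm t)

/-- The Möbius band, with the quotient topology: the quotient of the unit square by the
equivalence relation generated by `MobiusGlue`. -/
abbrev MobiusBand : Type := Quot MobiusGlue

/-- The central circle: the image of `[0,1] × {1/2}` in the Möbius band. -/
def centralCircle : Set MobiusBand :=
  Quot.mk MobiusGlue '' {p : I × I | (p.2 : ℝ) = 1 / 2}

/-! ### The pseudocircle -/

/-- The four points of the pseudocircle. -/
inductive Pseudocircle : Type
  | a | b | c | d

/-- The topology of the poset `a, b < c, d`: a set is open iff it is a down-set, so the minimal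
open neighbourhoods are `{a}`, `{b}`, `{a, b, c}` and `{a, b, d}`. -/
instance : TopologicalSpace Pseudocircle where
  IsOpen U := (.c ∈ U → .a ∈ U ∧ .b ∈ U) ∧ (.d ∈ U → .a ∈ U ∧ .b ∈ U)
  isOpen_univ := by simp
  isOpen_inter U V hU hV := by
    simp only [Set.mem_inter_iff]
    tauto
  isOpen_sUnion S hS := by
    constructor
    · rintro ⟨U, hU, h⟩
      exact ⟨⟨U, hU, ((hS U hU).1 h).1⟩, ⟨U, hU, ((hS U hU).1 h).2⟩⟩
    · rintro ⟨U, hU, h⟩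
      exact ⟨⟨U, hU, ((hS U hU).2 h).1⟩, ⟨U, hU, ((hS U hU).2 h).2⟩⟩

/-! ### Integral singular homology -/

/-- The `n`-th singular homology group of `X` with integer coefficients. -/
noncomputable abbrev integralHomology (n : ℕ) (X : Type) [TopologicalSpace X] : ModuleCat.{0} ℤ :=
  ((AlgebraicTopology.singularHomologyFunctor (ModuleCat.{0} ℤ) n).obj (ModuleCat.of ℤ ℤ)).obj
    (TopCat.of X)

/-! ### Lifting cubes and relative homotopies through covering maps. -/

section CoveringTools

/-! The fibres of the projection `mobiusProj` of the band onto the circle are intervals, so the band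
slides along them onto the image of any section. The heights `1/2 + u cos(π(s - s₀))` define
sections, because the cosine changes sign over one turn exactly as the gluing requires. The section
`u = 0` gives the central circle. Since some section passes through any prescribed point, the
projection has a pointed homotopy inverse at every base point and is a weak equivalence
(`mobius_homotopicRel`, `isWeakHomotopyEquivalence_mobiusProj`).

The homotopy groups of the circle come from the covering `Circle.exp`. For homology, singular
simplices lift to `ℝ` uniquely up to translation by multiples of `2π`, so `0 → C(ℝ) → C(ℝ) → C(S¹) →
0`, with first map "translation minus identity", is exact (`line_circle_shortExact`). The first map
is zero on homology and `ℝ` is acyclic in positive degrees, so the connecting map is an isomorphism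
from `H_{n+1}(S¹)` to `H_n(ℝ)`.

The pseudocircle is covered by an infinite fence, which is weakly contractible, and an equivariant
map from `ℝ` to the fence induces a weak equivalence from the circle to the pseudocircle
(`isWeakHomotopyEquivalence_circleToPseudocircle`). For minimality, a path connected space with at
most four points is reduced by removing beat points: it is contractible or the pseudocircle
(`contractible_or_homeomorph_pseudocircle`). A model of the circle is not simply connected, which
excludes the first case. -/

theorem ContinuousMap.HomotopicRel.precomp {X Y Z : Type*} [TopologicalSpace X]
    [TopologicalSpace Y] [TopologicalSpace Z] {f₀ f₁ : C(X, Y)} {S : Set X} {T : Set Z}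
    (h : f₀.HomotopicRel f₁ S) (g : C(Z, X)) (hg : Set.MapsTo g T S) :
    (f₀.comp g).HomotopicRel (f₁.comp g) T := by
  obtain ⟨H⟩ := h
  exact ⟨{ toContinuousMap := H.toContinuousMap.comp ((ContinuousMap.id I).prodMap g)
           map_zero_left := fun z => H.apply_zero (g z)
           map_one_left := fun z => H.apply_one (g z)
           prop' := fun t z hz => H.eq_fst t (hg hz) }⟩

/-- Any two maps into `ℝ` are homotopic relative to the set where they agree. -/
theorem Real.homotopicRel_of_eqOn {X : Type*} [TopologicalSpace X] {S : Set X} {f g : C(X, ℝ)}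
    (h : Set.EqOn f g S) : f.HomotopicRel g S :=
  ⟨{ toFun := fun z => (1 - (z.1 : ℝ)) * f z.2 + z.1 * g z.2
     continuous_toFun := by fun_prop
     map_zero_left := fun z => by simp
     map_one_left := fun z => by simp
     prop' := fun t z hz => by
      change (1 - (t : ℝ)) * f z + t * g z = f z
      rw [h hz]; ring }⟩

/-- A map from a cube lifts through a covering map, with prescribed value at the origin. -/
theorem IsCoveringMap.exists_cube_lift {E B N : Type*} [TopologicalSpace E] [TopologicalSpace B]
    {p : E → B} (hp : IsCoveringMap p) (q : C(I^N, B)) (e : E) (he : p e = q 0) :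
    ∃ Q : C(I^N, E), (∀ y, p (Q y) = q y) ∧ Q 0 = e := by
  -- Scaling the cube makes `q` the end of a homotopy that starts at a constant map, and constants
  -- lift.
  let H : C(I × (I^N), B) := q.comp ⟨fun z i => z.1 * z.2 i, by fun_prop⟩
  have H_zero : ∀ y, H (0, y) = p (ContinuousMap.const (I^N) e y) := fun y => by
    simp only [H, ContinuousMap.comp_apply, ContinuousMap.coe_mk, zero_mul,
      ContinuousMap.const_apply, he]
    rfl
  let L := hp.liftHomotopy H (ContinuousMap.const _ e) H_zero
  have hL : ∀ z, p (L z) = H z := fun z => congrFun (hp.liftHomotopy_lifts H _ H_zero) z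
  refine ⟨L.comp ⟨fun y => (1, y), by fun_prop⟩, fun y => ?_, ?_⟩
  · simp only [ContinuousMap.comp_apply, ContinuousMap.coe_mk, hL, H, one_mul]
  · have h0 : L (0, 0) = e := hp.liftHomotopy_zero H (ContinuousMap.const _ e) H_zero 0
    rw [← h0]
    refine hp.const_of_comp (g := fun t : I => L (t, (0 : I^N)))
      (L.continuous.comp (by fun_prop)) (fun t t' => ?_) 1 0
    simp only [hL, H, ContinuousMap.comp_apply, ContinuousMap.coe_mk, Pi.zero_apply, mul_zero]

theorem Cube.zero_mem_boundary (n : ℕ) : (0 : I^Fin (n + 1)) ∈ Cube.boundary (Fin (n + 1)) :=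
  ⟨0, Or.inl rfl⟩

/-- Every point of the boundary of a cube with at least two coordinates is joined to the origin
within the boundary. -/
theorem Cube.joinedIn_boundary_zero {N : Type*} [Nontrivial N] {y : I^N}
    (hy : y ∈ Cube.boundary N) : JoinedIn (Cube.boundary N) 0 y := by
  classical
  obtain ⟨i, hi⟩ := hy
  obtain ⟨j, hj⟩ := exists_ne i
  -- Coordinate `i` moves first, within the face where `j` vanishes; the others move afterwards,
  -- within the face fixed by the final value of coordinate `i`.
  refine JoinedIn.trans (y := fun k => if k = i then y i else 0) ?_ ?_
  · refine ⟨⟨⟨fun t k => if k = i then t * y i else 0, ?_⟩, ?_, ?_⟩, fun t => ⟨j, Or.inl ?_⟩⟩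
    · refine continuous_pi fun k => ?_
      split_ifs <;> fun_prop
    · ext k; simp
    · ext k; simp
    · exact if_neg hj
  · refine ⟨⟨⟨fun t k => if k = i then y i else t * y k, ?_⟩, ?_, ?_⟩, fun t => ⟨i, ?_⟩⟩
    · refine continuous_pi fun k => ?_
      split_ifs <;> fun_prop
    · ext k; simp
    · ext k
      by_cases h : k = i
      · simp [h]
      · simp [h]
    · simpa using hi

theorem Cube.isPreconnected_boundary (N : Type*) [Nontrivial N] :
    IsPreconnected (Cube.boundary N) := by
  have h0 : (0 : I^N) ∈ Cube.boundary N := ⟨(exists_pair_ne N).choose, Or.inl rfl⟩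
  have h : IsPathConnected (Cube.boundary N) :=
    ⟨0, h0, fun {_} hy => Cube.joinedIn_boundary_zero hy⟩
  exact h.isConnected.isPreconnected

/-- In degrees at least two, generalized loops lift to generalized loops. -/
theorem IsCoveringMap.exists_genLoop_lift {E B N : Type*} [TopologicalSpace E] [TopologicalSpace B]
    [Nontrivial N] {p : E → B} (hp : IsCoveringMap p) {b : B} (q : Ω^ N B b) (e : E)
    (he : p e = b) : ∃ Q : Ω^ N E e, ∀ y, p (Q y) = q y := by
  have h0 : (0 : I^N) ∈ Cube.boundary N := ⟨(exists_pair_ne N).choose, Or.inl rfl⟩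
  obtain ⟨Q, hQ, hQ0⟩ := hp.exists_cube_lift q.1 e (he.trans (q.2 0 h0).symm)
  refine ⟨⟨Q, fun y hy => ?_⟩, hQ⟩
  rw [← hQ0]
  refine hp.constOn_of_comp (Cube.isPreconnected_boundary N) Q.continuous.continuousOn
    (fun a ha a' ha' => ?_) hy h0
  rw [hQ, hQ]
  exact (q.2 a ha).trans (q.2 a' ha').symm

/-- In a simply connected space, maps from the 1-cube that agree on the boundary are homotopic
relative to it. -/
theorem SimplyConnectedSpace.homotopicRel_cube_one {E : Type*} [TopologicalSpace E]
    [SimplyConnectedSpace E] {P Q : C(I^Fin 1, E)} (h : Set.EqOn P Q (Cube.boundary (Fin 1))) :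
    P.HomotopicRel Q (Cube.boundary (Fin 1)) := by
  let c : C(I, I^Fin 1) := ⟨fun t _ => t, by fun_prop⟩
  let d : C(I^Fin 1, I) := ⟨fun y => y 0, by fun_prop⟩
  have hcd : c.comp d = ContinuousMap.id _ := by
    ext y i
    rw [Subsingleton.elim i 0]
    rfl
  let γ : Path (P (c 0)) (P (c 1)) := ⟨P.comp c, rfl, rfl⟩
  let δ : Path (P (c 0)) (P (c 1)) :=
    ⟨Q.comp c, (h ⟨0, Or.inl rfl⟩).symm, (h ⟨0, Or.inr rfl⟩).symm⟩
  have key : (P.comp c).HomotopicRel (Q.comp c) {0, 1} := SimplyConnectedSpace.paths_homotopic γ δ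
  have := key.precomp (T := Cube.boundary (Fin 1)) d (by
    rintro y ⟨i, hi⟩
    rw [Subsingleton.elim i 0] at hi
    exact hi)
  simpa only [ContinuousMap.comp_assoc, hcd, ContinuousMap.comp_id] using this

end CoveringTools

/-! ### Two criteria for weak homotopy equivalences. -/

section WeakEquivalenceCriteria

universe u

theorem inducedPiZero_bijective_of_pathConnected {X Y : Type u} [TopologicalSpace X]
    [TopologicalSpace Y] [PathConnectedSpace X] [PathConnectedSpace Y] (f : C(X, Y)) :
    Function.Bijective (inducedPiZero f) := by
  have hX := (pathConnectedSpace_iff_zerothHomotopy (X := X)).1 inferInstance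
  have hY := (pathConnectedSpace_iff_zerothHomotopy (X := Y)).1 inferInstance
  have := hX.2
  have := hY.2
  exact ⟨fun a b _ => Subsingleton.elim a b,
    fun b => ⟨hX.1.some, Subsingleton.elim _ b⟩⟩

/-- A map of path connected spaces which at each point has a pointed homotopy inverse is a weak
homotopy equivalence. -/
theorem isWeakHomotopyEquivalence_of_pointed {X Y : Type u} [TopologicalSpace X]
    [TopologicalSpace Y] [PathConnectedSpace X] [PathConnectedSpace Y] (f : C(X, Y))
    (h : ∀ x, ∃ g : C(Y, X), g (f x) = x ∧
      (f.comp g).HomotopicRel (ContinuousMap.id Y) {f x} ∧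
      (g.comp f).HomotopicRel (ContinuousMap.id X) {x}) :
    IsWeakHomotopyEquivalence f := by
  refine ⟨inducedPiZero_bijective_of_pathConnected f, fun n x => ?_⟩
  change Function.Bijective (inducedPi f (n + 1) x)
  obtain ⟨g, hg, hY, hX⟩ := h x
  constructor
  · rintro ⟨p⟩ ⟨q⟩ hpq
    refine Quotient.sound ?_
    have hpq' : (f.comp p.1).HomotopicRel (f.comp q.1) (Cube.boundary _) := Quotient.exact hpq
    have h1 := hpq'.comp_continuousMap g
    have h2 := hX.precomp (T := Cube.boundary _) p.1 p.2
    have h3 := hX.precomp (T := Cube.boundary _) q.1 q.2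
    exact (h2.symm.trans h1).trans h3
  · rintro ⟨q⟩
    refine ⟨Quotient.mk _ ⟨g.comp q.1, fun y hy => ?_⟩, Quotient.sound ?_⟩
    · exact (congrArg g (q.2 y hy)).trans hg
    · exact hY.precomp (T := Cube.boundary _) q.1 q.2

/-- A map covered by a map of weakly contractible covering spaces that is bijective on fibres is a
weak homotopy equivalence. -/
theorem isWeakHomotopyEquivalence_of_covering {E E' : Type*} {B B' : Type u} [TopologicalSpace E]
    [TopologicalSpace E'] [TopologicalSpace B] [TopologicalSpace B'] {p : E → B} {p' : E' → B'}
    [PathConnectedSpace E] [SimplyConnectedSpace E']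
    (hp : IsCoveringMap p) (hps : Function.Surjective p)
    (hp' : IsCoveringMap p') (hps' : Function.Surjective p') (f : C(B, B')) (F : C(E, E'))
    (hF : ∀ e, p' (F e) = f (p e))
    (hlift : ∀ b e', p' e' = f b → ∃ e, p e = b ∧ F e = e')
    (hinj : ∀ e₁ e₂, p e₁ = p e₂ → F e₁ = F e₂ → e₁ = e₂)
    (hE : ∀ (n : ℕ) (P Q : C(I^Fin n, E)), Set.EqOn P Q (Cube.boundary (Fin n)) →
      P.HomotopicRel Q (Cube.boundary (Fin n)))
    (hE' : ∀ (n : ℕ) (e : E') (Q : Ω^ (Fin n) E' e), GenLoop.Homotopic Q GenLoop.const) :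
    IsWeakHomotopyEquivalence f := by
  have : PathConnectedSpace B := hps.pathConnectedSpace hp.continuous
  have : PathConnectedSpace B' := hps'.pathConnectedSpace hp'.continuous
  refine ⟨inducedPiZero_bijective_of_pathConnected f, fun n x => ?_⟩
  change Function.Bijective (inducedPi f (n + 1) x)
  have h0 := Cube.zero_mem_boundary n
  obtain ⟨e, rfl⟩ := hps x
  let pc : C(E, B) := ⟨p, hp.continuous⟩
  let pc' : C(E', B') := ⟨p', hp'.continuous⟩
  constructor
  · rintro ⟨q₁⟩ ⟨q₂⟩ hq
    refine Quotient.sound ?_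
    have hq' : (f.comp q₁.1).HomotopicRel (f.comp q₂.1) (Cube.boundary _) := Quotient.exact hq
    obtain ⟨Q₁, hQ₁, h₁0⟩ := hp.exists_cube_lift q₁.1 e (q₁.2 0 h0).symm
    obtain ⟨Q₂, hQ₂, h₂0⟩ := hp.exists_cube_lift q₂.1 e (q₂.2 0 h0).symm
    have e₁ : pc'.comp (F.comp Q₁) = f.comp q₁.1 := by
      ext y; exact (hF _).trans (congrArg f (hQ₁ y))
    have e₂ : pc'.comp (F.comp Q₂) = f.comp q₂.1 := by
      ext y; exact (hF _).trans (congrArg f (hQ₂ y))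
    rw [← e₁, ← e₂] at hq'
    -- The homotopy downstairs lifts relative to the boundary, so the two lifts agree there after
    -- `F`; injectivity on fibres removes `F`.
    have hlifts := (hp'.homotopicRel_iff_comp (f₀ := F.comp Q₁) (f₁ := F.comp Q₂)
      ⟨0, h0, by simp [h₁0, h₂0]⟩).2 hq'
    have hbd : Set.EqOn Q₁ Q₂ (Cube.boundary (Fin (n + 1))) := fun y hy =>
      hinj _ _ (by rw [hQ₁, hQ₂]; exact (q₁.2 y hy).trans (q₂.2 y hy).symm)
        (hlifts.fst_eq_snd hy)
    have key := (hE _ Q₁ Q₂ hbd).comp_continuousMap pc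
    have c₁ : pc.comp Q₁ = q₁.1 := ContinuousMap.ext hQ₁
    have c₂ : pc.comp Q₂ = q₂.1 := ContinuousMap.ext hQ₂
    rwa [c₁, c₂] at key
  · rintro ⟨q⟩
    -- The boundary of the 1-cube is disconnected, so a lifted loop may end at another point of the
    -- fibre; in higher degrees the lift is again a loop.
    match n with
    | 0 =>
      obtain ⟨Q, hQ, hQ0⟩ := hp'.exists_cube_lift q.1 (F e) ((hF e).trans (q.2 0 h0).symm)
      have h1 : (1 : I^Fin 1) ∈ Cube.boundary (Fin 1) := ⟨0, Or.inr rfl⟩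
      obtain ⟨e₁, he₁, hFe₁⟩ := hlift (p e) (Q 1) ((hQ 1).trans (q.2 1 h1))
      let γ := PathConnectedSpace.somePath e e₁
      let P : C(I^Fin 1, E) := γ.toContinuousMap.comp ⟨fun y => y 0, by fun_prop⟩
      have hP : ∀ y ∈ Cube.boundary (Fin 1), (y = 0 ∧ P y = e) ∨ (y = 1 ∧ P y = e₁) := by
        rintro y ⟨i, hi⟩
        rw [Subsingleton.elim i 0] at hi
        refine hi.imp (fun hi => ⟨?_, ?_⟩) (fun hi => ⟨?_, ?_⟩)
        · ext j; rw [Subsingleton.elim j 0, hi]; rfl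
        · change γ (y 0) = e; rw [hi, γ.source]
        · ext j; rw [Subsingleton.elim j 0, hi]; rfl
        · change γ (y 0) = e₁; rw [hi, γ.target]
      refine ⟨Quotient.mk _ ⟨pc.comp P, fun y hy => ?_⟩, Quotient.sound ?_⟩
      · rcases hP y hy with ⟨-, h⟩ | ⟨-, h⟩
        · exact congrArg p h
        · exact (congrArg p h).trans he₁
      · have hbd : Set.EqOn (F.comp P) Q (Cube.boundary (Fin 1)) := fun y hy => by
          rcases hP y hy with ⟨rfl, h⟩ | ⟨rfl, h⟩
          · simp [h, hQ0]
          · simp [h, hFe₁]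
        have key := (SimplyConnectedSpace.homotopicRel_cube_one hbd).comp_continuousMap pc'
        have c₁ : pc'.comp (F.comp P) = f.comp (pc.comp P) := by
          ext y; exact hF _
        have c₂ : pc'.comp Q = q.1 := ContinuousMap.ext hQ
        rw [c₁, c₂] at key
        exact key
    | m + 1 =>
      obtain ⟨Q, hQ⟩ := hp'.exists_genLoop_lift q (F e) (hF e)
      refine ⟨Quotient.mk _ GenLoop.const, Quotient.sound ?_⟩
      have key : (pc'.comp Q.1).HomotopicRel (pc'.comp GenLoop.const.1) (Cube.boundary _) :=
        (hE' _ _ Q).comp_continuousMap pc'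
      have c₁ : pc'.comp (GenLoop.const (N := Fin (m + 1 + 1)) (x := F e)).1 =
          f.comp (GenLoop.const (N := Fin (m + 1 + 1)) (x := p e)).1 := by
        ext y; exact hF e
      have c₂ : pc'.comp Q.1 = q.1 := ContinuousMap.ext hQ
      rw [c₁, c₂] at key
      exact key.symm

end WeakEquivalenceCriteria

/-! ### The Möbius band as an interval bundle over the circle. -/

section Mobius

/-- The loop going once around the circle. -/
noncomputable def circleLoop : C(I, Circle) :=
  ⟨fun s => Circle.exp (2 * Real.pi * s), by fun_prop⟩

theorem circleLoop_apply (s : I) : circleLoop s = Circle.exp (2 * Real.pi * s) := rfl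

theorem circleLoop_zero : circleLoop 0 = 1 := by simp [circleLoop_apply]

theorem circleLoop_one : circleLoop 1 = 1 := by simp [circleLoop_apply]

theorem circleLoop_surjective : Function.Surjective circleLoop := by
  intro z
  obtain ⟨x, rfl⟩ := Circle.exp_surjective z
  refine ⟨⟨Int.fract (x / (2 * Real.pi)), Int.fract_nonneg _, (Int.fract_lt_one _).le⟩, ?_⟩
  rw [circleLoop_apply, Circle.exp_eq_exp]
  refine ⟨-⌊x / (2 * Real.pi)⌋, ?_⟩
  have := Int.self_sub_floor (x / (2 * Real.pi))
  simp only
  rw [← this]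
  push_cast
  field_simp
  ring

theorem circleLoop_eq_iff {s t : I} :
    circleLoop s = circleLoop t ↔ s = t ∨ (s = 0 ∧ t = 1) ∨ (s = 1 ∧ t = 0) := by
  constructor
  · intro h
    rw [circleLoop_apply, circleLoop_apply, Circle.exp_eq_exp] at h
    obtain ⟨m, hm⟩ := h
    have hπ := Real.pi_pos
    have h1 : (s : ℝ) = t + m := by
      have : 2 * Real.pi * (s : ℝ) = 2 * Real.pi * (t + m) := by rw [hm]; ring
      exact mul_left_cancel₀ (by positivity) this
    have hs := s.2
    have ht := t.2
    have hm1 : m ≤ 1 := by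
      have : (m : ℝ) ≤ 1 := by linarith [hs.2, ht.1]
      exact_mod_cast this
    have hm2 : -1 ≤ m := by
      have : (-1 : ℝ) ≤ m := by linarith [hs.1, ht.2]
      exact_mod_cast this
    obtain rfl | rfl | rfl : m = -1 ∨ m = 0 ∨ m = 1 := by omega
    · refine Or.inr (Or.inl ⟨Subtype.ext ?_, Subtype.ext ?_⟩)
      · push_cast at h1; change (s : ℝ) = 0; linarith [hs.1, ht.2]
      · push_cast at h1; change (t : ℝ) = 1; linarith [hs.1, ht.2]
    · exact Or.inl (Subtype.ext (by simpa using h1))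
    · refine Or.inr (Or.inr ⟨Subtype.ext ?_, Subtype.ext ?_⟩)
      · push_cast at h1; change (s : ℝ) = 1; linarith [hs.2, ht.1]
      · push_cast at h1; change (t : ℝ) = 0; linarith [hs.2, ht.1]
  · rintro (rfl | ⟨rfl, rfl⟩ | ⟨rfl, rfl⟩)
    · rfl
    · rw [circleLoop_zero, circleLoop_one]
    · rw [circleLoop_zero, circleLoop_one]

theorem isQuotientMap_circleLoop : Topology.IsQuotientMap circleLoop :=
  circleLoop.continuous.isClosedMap.isQuotientMap circleLoop.continuous circleLoop_surjective

instance : PathConnectedSpace Circle :=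
  Circle.exp_surjective.pathConnectedSpace Circle.exp.continuous

instance : PathConnectedSpace MobiusBand := by
  have : PathConnectedSpace I := isPathConnected_iff_pathConnectedSpace.1
    ((convex_Icc (0 : ℝ) 1).isPathConnected (Set.nonempty_Icc.2 zero_le_one))
  have : PathConnectedSpace (I × I) := by infer_instance
  exact Quot.mk_surjective.pathConnectedSpace (f := Quot.mk MobiusGlue) continuous_quot_mk

/-- The projection of the Möbius band onto the circle. -/
noncomputable def mobiusProj : C(MobiusBand, Circle) where
  toFun := Quot.lift (fun p => circleLoop p.1) (by
    rintro _ _ ⟨t, rfl, rfl⟩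
    exact circleLoop_zero.trans circleLoop_one.symm)
  continuous_toFun := continuous_quot_lift _ (by fun_prop)

/-- The height over `s` of the section of the Möbius band that has height `1/2 + u` over `s₀`. -/
noncomputable def mobiusHeight (s₀ : ℝ) (u : Set.Icc (-1/2 : ℝ) (1/2)) : C(I, I) where
  toFun s := ⟨1/2 + u * Real.cos (Real.pi * (s - s₀)), by
    obtain ⟨u, hu⟩ := u
    have h1 := Real.abs_cos_le_one (Real.pi * (s - s₀))
    have h2 : |u| ≤ 1/2 := abs_le.2 ⟨by linarith [hu.1], hu.2⟩
    have h3 : |u * Real.cos (Real.pi * (s - s₀))| ≤ 1/2 := by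
      rw [abs_mul]
      calc _ ≤ 1/2 * 1 := mul_le_mul h2 h1 (abs_nonneg _) (by norm_num)
        _ = _ := by norm_num
    have h4 := abs_le.1 h3
    exact ⟨by simp only; linarith [h4.1], by simp only; linarith [h4.2]⟩⟩
  continuous_toFun := by fun_prop

variable (s₀ : ℝ) (u : Set.Icc (-1/2 : ℝ) (1/2))

theorem coe_mobiusHeight (s : I) :
    (mobiusHeight s₀ u s : ℝ) = 1/2 + u * Real.cos (Real.pi * (s - s₀)) := rfl

/-- The cosine changes sign when its argument grows by `π`; this is the twist of the band, and it
makes the section close up. -/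
theorem mobiusHeight_one : mobiusHeight s₀ u 1 = unitInterval.symm (mobiusHeight s₀ u 0) := by
  ext
  rw [unitInterval.coe_symm_eq, coe_mobiusHeight, coe_mobiusHeight]
  have : Real.cos (Real.pi * (((1 : I) : ℝ) - s₀)) = - Real.cos (Real.pi * (((0 : I) : ℝ) - s₀)) := by
    rw [← Real.cos_add_pi]
    congr 1
    simp only [Set.Icc.coe_one, Set.Icc.coe_zero]
    ring
  rw [this]
  ring

theorem mobius_glue (t : I) :
    (Quot.mk MobiusGlue (0, t) : MobiusBand) = Quot.mk _ (1, unitInterval.symm t) :=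
  Quot.sound ⟨t, rfl, rfl⟩

/-- The path in the Möbius band with height `1/2 + u` over `s₀`. -/
noncomputable def mobiusPath : C(I, MobiusBand) :=
  ⟨fun s => Quot.mk _ (s, mobiusHeight s₀ u s), continuous_quot_mk.comp (by fun_prop)⟩

theorem mobiusPath_factorsThrough : Function.FactorsThrough (mobiusPath s₀ u) circleLoop := by
  have key : mobiusPath s₀ u 0 = mobiusPath s₀ u 1 := by
    change Quot.mk _ (_, _) = Quot.mk _ (_, _)
    rw [mobiusHeight_one]
    exact mobius_glue _
  intro s t h
  rcases circleLoop_eq_iff.1 h with rfl | ⟨rfl, rfl⟩ | ⟨rfl, rfl⟩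
  · rfl
  · exact key
  · exact key.symm

/-- The section of the Möbius band with height `1/2 + u` over `s₀`. -/
noncomputable def mobiusSection : C(Circle, MobiusBand) :=
  isQuotientMap_circleLoop.lift (mobiusPath s₀ u) (mobiusPath_factorsThrough s₀ u)

theorem mobiusSection_circleLoop (s : I) :
    mobiusSection s₀ u (circleLoop s) = Quot.mk _ (s, mobiusHeight s₀ u s) :=
  DFunLike.congr_fun (isQuotientMap_circleLoop.lift_comp _ (mobiusPath_factorsThrough s₀ u)) s

theorem mobiusProj_comp_mobiusSection :
    mobiusProj.comp (mobiusSection s₀ u) = ContinuousMap.id Circle := by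
  ext1 z
  obtain ⟨s, rfl⟩ := circleLoop_surjective z
  rw [ContinuousMap.comp_apply, mobiusSection_circleLoop]
  rfl

/-- The image of the section of height `1/2 + u` over `s₀`. -/
def mobiusCurve : Set MobiusBand :=
  Quot.mk MobiusGlue '' {p : I × I | p.2 = mobiusHeight s₀ u p.1}

/-- The straight-line motion in a fibre of the Möbius band, at time `τ`. -/
noncomputable def mobiusSlide (z : I × I × I) : I × I :=
  (z.2.1, ⟨(1 - (z.1 : ℝ)) * z.2.2 + z.1 * mobiusHeight s₀ u z.2.1,
    (convex_Icc (0 : ℝ) 1) z.2.2.2 (mobiusHeight s₀ u z.2.1).2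
      (by linarith [z.1.2.2]) z.1.2.1 (by ring)⟩)

theorem continuous_mobiusSlide : Continuous (mobiusSlide s₀ u) := by
  unfold mobiusSlide
  fun_prop

/-- Fibres are convex, and the straight-line motion commutes with the flip `t ↦ 1 - t` because both
of its endpoints are flipped. Points already on the curve do not move. -/
theorem mobius_homotopicRel :
    (ContinuousMap.id MobiusBand).HomotopicRel ((mobiusSection s₀ u).comp mobiusProj)
      (mobiusCurve s₀ u) := by
  refine ⟨{ toFun := fun z => Quot.lift
              (fun p => (Quot.mk _ (mobiusSlide s₀ u (z.1, p)) : MobiusBand)) ?_ z.2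
            continuous_toFun := ?_
            map_zero_left := ?_
            map_one_left := ?_
            prop' := ?_ }⟩
  · rintro _ _ ⟨t, rfl, rfl⟩
    refine (mobius_glue _).trans (congrArg (Quot.mk _) (Prod.ext rfl (Subtype.ext ?_)))
    simp only [mobiusSlide, unitInterval.coe_symm_eq, mobiusHeight_one]
    ring
  -- The product of the quotient map with the locally compact `I` is still a quotient map.
  · exact (isQuotientMap_quot_mk (r := MobiusGlue)).continuous_lift_prod_right
      (continuous_quot_mk.comp (continuous_mobiusSlide s₀ u))
  · rintro ⟨p⟩
    exact congrArg (Quot.mk _) (Prod.ext rfl (Subtype.ext (by simp [mobiusSlide])))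
  · rintro ⟨p⟩
    refine Eq.trans ?_ (mobiusSection_circleLoop s₀ u p.1).symm
    exact congrArg (Quot.mk _) (Prod.ext rfl (Subtype.ext (by simp [mobiusSlide])))
  · rintro t _ ⟨p, hp, rfl⟩
    refine congrArg (Quot.mk _) (Prod.ext rfl (Subtype.ext ?_))
    simp only [mobiusSlide]
    rw [show p.2 = mobiusHeight s₀ u p.1 from hp]
    ring

theorem exists_mem_mobiusCurve (x : MobiusBand) : ∃ s₀ u, x ∈ mobiusCurve s₀ u := by
  obtain ⟨⟨s, t⟩, rfl⟩ := Quot.exists_rep x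
  -- With `s₀ = s` the cosine is `1` at `s`, so the height there is `1/2 + u = t`.
  refine ⟨s, ⟨t - 1/2, by linarith [t.2.1], by linarith [t.2.2]⟩, (s, t), Subtype.ext ?_, rfl⟩
  simp [coe_mobiusHeight]

theorem mobiusCurve_zero : mobiusCurve 0 ⟨0, by norm_num⟩ = centralCircle := by
  unfold mobiusCurve centralCircle
  congr 1
  ext p
  simp only [Set.mem_ofPred_eq, Subtype.ext_iff, coe_mobiusHeight, zero_mul, add_zero]

theorem mobiusSection_mem (z : Circle) : mobiusSection s₀ u z ∈ mobiusCurve s₀ u := by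
  obtain ⟨s, rfl⟩ := circleLoop_surjective z
  rw [mobiusSection_circleLoop]
  exact ⟨_, rfl, rfl⟩

theorem mobiusSection_mobiusProj {x : MobiusBand} (hx : x ∈ mobiusCurve s₀ u) :
    mobiusSection s₀ u (mobiusProj x) = x :=
  ((mobius_homotopicRel s₀ u).fst_eq_snd hx).symm

theorem deformationRetractsOnto_centralCircle :
    DeformationRetractsOnto MobiusBand centralCircle := by
  rw [← mobiusCurve_zero]
  exact ⟨_, fun x => mobiusSection_mem _ _ _, mobius_homotopicRel _ _⟩

theorem nonempty_centralCircle_homeomorph : Nonempty (centralCircle ≃ₜ Circle) := by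
  rw [← mobiusCurve_zero]
  exact ⟨{ toFun := fun x => mobiusProj x.1
           invFun := fun z => ⟨mobiusSection _ _ z, mobiusSection_mem _ _ z⟩
           left_inv := fun x => Subtype.ext (mobiusSection_mobiusProj _ _ x.2)
           right_inv := fun z => DFunLike.congr_fun (mobiusProj_comp_mobiusSection _ _) z
           continuous_toFun := by fun_prop
           continuous_invFun := by fun_prop }⟩

/-- The Möbius band is homotopy equivalent to the circle. -/
noncomputable def mobiusHomotopyEquiv : ContinuousMap.HomotopyEquiv MobiusBand Circle where
  toFun := mobiusProj
  invFun := mobiusSection 0 ⟨0, by norm_num⟩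
  left_inv := (mobius_homotopicRel _ _).homotopic.symm
  right_inv := by rw [mobiusProj_comp_mobiusSection]

/-- The section is chosen through the base point, so the homotopies fix it and no change of base
point is needed. -/
theorem isWeakHomotopyEquivalence_mobiusProj : IsWeakHomotopyEquivalence mobiusProj := by
  refine isWeakHomotopyEquivalence_of_pointed _ fun x => ?_
  obtain ⟨s₀, u, hx⟩ := exists_mem_mobiusCurve x
  refine ⟨mobiusSection s₀ u, mobiusSection_mobiusProj s₀ u hx, ?_, ?_⟩
  · rw [mobiusProj_comp_mobiusSection]
    exact .refl _
  · obtain ⟨H⟩ := (mobius_homotopicRel s₀ u).symm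
    exact ⟨{ H.toHomotopy with
      prop' := fun t y hy => H.prop' t y (by rw [Set.mem_singleton_iff.1 hy]; exact hx) }⟩

end Mobius

/-! ### Exactness of `T - 1` on the free module over a set with free orbits. -/

section FinsuppExact

variable {S B : Type*} {T : S → S} {f : S → B}

/-- The endomorphism `T - 1` of the free module on a set with a self-map `T`. -/
noncomputable def finsuppSub (T : S → S) : (S →₀ ℤ) →ₗ[ℤ] (S →₀ ℤ) :=
  Finsupp.lmapDomain ℤ ℤ T - LinearMap.id

/-- A function in the kernel is constant along the forward orbits of `T`, which are infinite,
whereas its support is finite. -/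
theorem finsuppSub_injective (hT : Function.Injective T)
    (hfree : ∀ x (k : ℕ), 0 < k → T^[k] x ≠ x) : Function.Injective (finsuppSub T) := by
  rw [← LinearMap.ker_eq_bot, LinearMap.ker_eq_bot']
  intro g hg
  have hg' : Finsupp.mapDomain T g = g := sub_eq_zero.1 hg
  have hiter : ∀ x (k : ℕ), g (T^[k] x) = g x := by
    intro x k
    induction k with
    | zero => rfl
    | succ k ih =>
      rw [Function.iterate_succ_apply', ← ih]
      conv_lhs => rw [← hg']
      exact Finsupp.mapDomain_apply hT g _
  ext x
  by_contra hx
  have hmaps : ∀ k : ℕ, T^[k] x ∈ g.support := fun k => by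
    rw [Finsupp.mem_support_iff, hiter]; exact hx
  have hinj : Function.Injective fun k : ℕ => T^[k] x := by
    intro a b hab
    by_contra hne
    rcases lt_or_gt_of_ne hne with h | h
    · refine hfree x (b - a) (by omega) (hT.iterate a ?_)
      rw [← Function.iterate_add_apply, Nat.add_sub_cancel' h.le]
      exact hab.symm
    · refine hfree x (a - b) (by omega) (hT.iterate b ?_)
      rw [← Function.iterate_add_apply, Nat.add_sub_cancel' h.le]
      exact hab
  exact Set.infinite_of_injective_forall_mem hinj hmaps g.support.finite_toSet

theorem single_iterate_sub_mem_range_finsuppSub (x : S) (k : ℕ) (c : ℤ) :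
    Finsupp.single (T^[k] x) c - Finsupp.single x c ∈ LinearMap.range (finsuppSub T) := by
  induction k with
  | zero => simp
  | succ k ih =>
    have h : Finsupp.single (T^[k + 1] x) c - Finsupp.single (T^[k] x) c ∈
        LinearMap.range (finsuppSub T) := ⟨Finsupp.single (T^[k] x) c, by
      simp [finsuppSub, Finsupp.lmapDomain_apply, Finsupp.mapDomain_single,
        Function.iterate_succ_apply']⟩
    simpa using Submodule.add_mem _ h ih

/-- Moving each point to a chosen representative of its fibre changes a chain only by an element of
the range of `T - 1`; a chain killed by `f` becomes zero after this move. -/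
theorem finsuppSub_exact (hf : Function.Surjective f) (hTf : ∀ x, f (T x) = f x)
    (horb : ∀ x y, f x = f y → ∃ k : ℕ, y = T^[k] x ∨ x = T^[k] y) :
    Function.Exact (finsuppSub T) (Finsupp.lmapDomain ℤ ℤ f) := by
  intro g
  constructor
  · intro hg
    obtain ⟨s, hs⟩ := hf.hasRightInverse
    have key : ∀ g : S →₀ ℤ, g - Finsupp.mapDomain (s ∘ f) g ∈ LinearMap.range (finsuppSub T) := by
      intro g
      induction g using Finsupp.induction_linear with
      | zero => simp
      | add g h hg hh =>
        rw [Finsupp.mapDomain_add, add_sub_add_comm]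
        exact Submodule.add_mem _ hg hh
      | single x c =>
        rw [Finsupp.mapDomain_single]
        obtain ⟨k, hk | hk⟩ := horb x ((s ∘ f) x) (hs (f x)).symm
        · rw [hk, ← neg_sub]
          exact Submodule.neg_mem _ (single_iterate_sub_mem_range_finsuppSub x k c)
        · nth_rewrite 1 [hk]
          exact single_iterate_sub_mem_range_finsuppSub _ k c
    have h0 : Finsupp.mapDomain (s ∘ f) g = 0 := by
      rw [Finsupp.mapDomain_comp, ← Finsupp.lmapDomain_apply ℤ ℤ f, hg, Finsupp.mapDomain_zero]
    simpa [h0] using key g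
  · rintro ⟨h, rfl⟩
    have : f ∘ T = f := funext hTf
    change Finsupp.lmapDomain ℤ ℤ f (Finsupp.mapDomain T h - h) = 0
    rw [map_sub, Finsupp.lmapDomain_apply, Finsupp.lmapDomain_apply, ← Finsupp.mapDomain_comp,
      this, sub_self]

end FinsuppExact

/-! ### Singular chains of the covering of the circle by the line. -/

section CoveringHomology

open CategoryTheory Limits AlgebraicTopology Simplicial

/-- The generator of the simplicial chains corresponding to a simplex. -/
noncomputable def chainGenerator (X : SSet.{0}) {n : ℕ} (x : X _⦋n⦌) :
    (X.chainComplex (ModuleCat.of ℤ ℤ)).X n :=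
  (X.ιChainComplex (R := ModuleCat.of ℤ ℤ) x).hom (1 : ℤ)

theorem chainComplexMap_chainGenerator {X Y : SSet.{0}} (f : X ⟶ Y) {n : ℕ} (x : X _⦋n⦌) :
    ((SSet.chainComplexMap f (ModuleCat.of ℤ ℤ)).f n).hom (chainGenerator X x) =
      chainGenerator Y (f.app _ x) :=
  LinearMap.congr_fun (congrArg ModuleCat.Hom.hom
    (SSet.ι_chainComplexMap_f X Y f (ModuleCat.of ℤ ℤ) x)) (1 : ℤ)

/-- The coordinates of a simplicial chain. -/
noncomputable def chainCoordinates (X : SSet.{0}) (n : ℕ) :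
    (X.chainComplex (ModuleCat.of ℤ ℤ)).X n ⟶ ModuleCat.of ℤ (X _⦋n⦌ →₀ ℤ) :=
  Cofan.IsColimit.desc (X.isColimitChainComplexXCofan (ModuleCat.of ℤ ℤ) n)
    fun x => ModuleCat.ofHom (Finsupp.lsingle (R := ℤ) (M := ℤ) x)

theorem ιChainComplex_chainCoordinates (X : SSet.{0}) {n : ℕ} (x : X _⦋n⦌) :
    X.ιChainComplex x ≫ chainCoordinates X n =
      ModuleCat.ofHom (Finsupp.lsingle (R := ℤ) (M := ℤ) x) :=
  Cofan.IsColimit.fac (X.isColimitChainComplexXCofan (ModuleCat.of ℤ ℤ) n) _ x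

theorem chainCoordinates_chainGenerator (X : SSet.{0}) {n : ℕ} (x : X _⦋n⦌) :
    (chainCoordinates X n).hom (chainGenerator X x) = Finsupp.single x 1 :=
  LinearMap.congr_fun (congrArg ModuleCat.Hom.hom (ιChainComplex_chainCoordinates X x)) (1 : ℤ)

/-- Finitely supported functions on simplices are simplicial chains with integer coefficients. -/
noncomputable def finsuppToChain (X : SSet.{0}) (n : ℕ) :
    ModuleCat.of ℤ (X _⦋n⦌ →₀ ℤ) ⟶ (X.chainComplex (ModuleCat.of ℤ ℤ)).X n :=
  ModuleCat.ofHom (Finsupp.linearCombination ℤ (chainGenerator X))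

theorem hom_linearCombination_single {S : Type} {M : ModuleCat.{0} ℤ} (v : S → M) (x : S) :
    (ModuleCat.ofHom (Finsupp.linearCombination ℤ v)).hom (Finsupp.single x 1) = v x := by
  simp only [ModuleCat.hom_ofHom, Finsupp.linearCombination_single]
  exact M.isModule.toMulAction.one_smul (v x)

theorem finsuppToChain_single (X : SSet.{0}) {n : ℕ} (x : X _⦋n⦌) :
    (finsuppToChain X n).hom (Finsupp.single x 1) = chainGenerator X x :=
  hom_linearCombination_single (chainGenerator X) x

/-- Simplicial chains with integer coefficients are finitely supported functions on simplices. -/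
noncomputable def chainComplexIsoFinsupp (X : SSet.{0}) (n : ℕ) :
    ModuleCat.of ℤ (X _⦋n⦌ →₀ ℤ) ≅ (X.chainComplex (ModuleCat.of ℤ ℤ)).X n where
  hom := finsuppToChain X n
  inv := chainCoordinates X n
  hom_inv_id := by
    refine ModuleCat.hom_ext (Finsupp.lhom_ext' fun x => LinearMap.ext_ring ?_)
    change (chainCoordinates X n).hom ((finsuppToChain X n).hom (Finsupp.single x 1)) =
      Finsupp.single x 1
    rw [finsuppToChain_single, chainCoordinates_chainGenerator]
  inv_hom_id := by
    refine SSet.chainComplex_hom_ext fun x => ModuleCat.hom_ext (LinearMap.ext_ring ?_)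
    change (finsuppToChain X n).hom ((chainCoordinates X n).hom (chainGenerator X x)) =
      chainGenerator X x
    rw [chainCoordinates_chainGenerator, finsuppToChain_single]

theorem finsuppToChain_naturality {X Y : SSet.{0}} (f : X ⟶ Y) (n : ℕ) :
    finsuppToChain X n ≫ (SSet.chainComplexMap f (ModuleCat.of ℤ ℤ)).f n =
      ModuleCat.ofHom (Finsupp.lmapDomain ℤ ℤ (f.app (.op ⦋n⦌))) ≫ finsuppToChain Y n := by
  refine ModuleCat.hom_ext (Finsupp.lhom_ext' fun x => LinearMap.ext_ring ?_)
  change ((SSet.chainComplexMap f (ModuleCat.of ℤ ℤ)).f n).hom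
      ((finsuppToChain X n).hom (Finsupp.single x 1)) =
    (finsuppToChain Y n).hom (Finsupp.mapDomain (f.app (.op ⦋n⦌)) (Finsupp.single x 1))
  rw [Finsupp.mapDomain_single, finsuppToChain_single, finsuppToChain_single,
    chainComplexMap_chainGenerator]

/-- The sequence of chain complexes `C(S) → C(S) → C(B)` given by `T - 1` and `f`. -/
noncomputable def cyclicQuotientSequence {S B : SSet.{0}} (T : S ⟶ S) (f : S ⟶ B)
    (h : T ≫ f = f) : ShortComplex (ChainComplex (ModuleCat.{0} ℤ) ℕ) :=
  ShortComplex.mk (SSet.chainComplexMap T (ModuleCat.of ℤ ℤ) - 𝟙 _)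
    (SSet.chainComplexMap f (ModuleCat.of ℤ ℤ)) (by
      rw [Preadditive.sub_comp, Category.id_comp, sub_eq_zero, SSet.chainComplexMap,
        SSet.chainComplexMap, ← Functor.map_comp, h])

/-- Chains on the quotient of a simplicial set by a free action of an infinite cyclic group. -/
theorem cyclicQuotientSequence_shortExact {S B : SSet.{0}} (T : S ⟶ S) (f : S ⟶ B)
    (h : T ≫ f = f) (hT : ∀ n : ℕ, Function.Injective (T.app (.op ⦋n⦌)))
    (hfree : ∀ (n : ℕ) (x : S _⦋n⦌) (k : ℕ), 0 < k → (T.app (.op ⦋n⦌))^[k] x ≠ x)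
    (hf : ∀ n : ℕ, Function.Surjective (f.app (.op ⦋n⦌)))
    (horb : ∀ (n : ℕ) (x y : S _⦋n⦌), f.app _ x = f.app _ y →
      ∃ k : ℕ, y = (T.app (.op ⦋n⦌))^[k] x ∨ x = (T.app (.op ⦋n⦌))^[k] y) :
    (cyclicQuotientSequence T f h).ShortExact := by
  refine HomologicalComplex.shortExact_of_degreewise_shortExact _ fun n => ?_
  have hTf : ∀ x, f.app (.op ⦋n⦌) (T.app (.op ⦋n⦌) x) = f.app (.op ⦋n⦌) x := fun x => by
    conv_rhs => rw [← h]
    rfl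
  have hex := finsuppSub_exact (hf n) hTf (horb n)
  let A : ShortComplex (ModuleCat.{0} ℤ) :=
    ShortComplex.mk (ModuleCat.ofHom (finsuppSub (T.app (.op ⦋n⦌))))
      (ModuleCat.ofHom (Finsupp.lmapDomain ℤ ℤ (f.app (.op ⦋n⦌)))) (by
        refine ModuleCat.hom_ext (LinearMap.ext fun g => ?_)
        exact (hex _).2 ⟨g, rfl⟩)
  have hA : A.ShortExact :=
    { exact := (ShortComplex.ShortExact.moduleCat_exact_iff_function_exact A).2 hex
      mono_f := (ModuleCat.mono_iff_injective _).2 (finsuppSub_injective (hT n) (hfree n))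
      epi_g := (ModuleCat.epi_iff_surjective _).2 (Finsupp.mapDomain_surjective (hf n)) }
  refine ShortComplex.shortExact_of_iso (ShortComplex.isoMk (chainComplexIsoFinsupp S n)
    (chainComplexIsoFinsupp S n) (chainComplexIsoFinsupp B n) ?_ ?_) hA
  · change finsuppToChain S n ≫ ((SSet.chainComplexMap T (ModuleCat.of ℤ ℤ)).f n - 𝟙 _) =
      ModuleCat.ofHom (finsuppSub (T.app (.op ⦋n⦌))) ≫ finsuppToChain S n
    rw [Preadditive.comp_sub, finsuppToChain_naturality, Category.comp_id]
    refine ModuleCat.hom_ext (LinearMap.ext fun g => ?_)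
    exact (map_sub (finsuppToChain S n).hom _ _).symm
  · exact finsuppToChain_naturality f n

theorem toSSetObjEquiv_map {X Y : TopCat.{0}} (f : X ⟶ Y) (n : SimplexCategoryᵒᵖ)
    (x : (TopCat.toSSet.obj X).obj n) :
    Y.toSSetObjEquiv n ((TopCat.toSSet.map f).app n x) = f.hom.comp (X.toSSetObjEquiv n x) := rfl


theorem stdSimplex_locallyPathConnectedSpace (n : ℕ) :
    LocallyPathConnectedSpace (stdSimplex ℝ (Fin (n + 1))) :=
  (convex_stdSimplex ℝ _).locallyPathConnectedSpace

theorem stdSimplex_contractibleSpace (n : ℕ) : ContractibleSpace (stdSimplex ℝ (Fin (n + 1))) :=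
  (convex_stdSimplex ℝ _).contractibleSpace ⟨_, ite_eq_mem_stdSimplex ℝ 0⟩

/-- The translation of the real line by `2π`. -/
noncomputable def lineShift : C(ℝ, ℝ) := ⟨fun x => x + 2 * Real.pi, by fun_prop⟩

theorem lineShift_iterate (k : ℕ) (x : ℝ) : lineShift^[k] x = x + k * (2 * Real.pi) := by
  induction k with
  | zero => simp
  | succ k ih =>
    rw [Function.iterate_succ_apply', ih]
    simp only [lineShift, ContinuousMap.coe_mk]
    push_cast
    ring

/-- The action of the translation by `2π` on singular simplices. -/
noncomputable def singularShift :
    TopCat.toSSet.obj (TopCat.of ℝ) ⟶ TopCat.toSSet.obj (TopCat.of ℝ) :=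
  TopCat.toSSet.map (TopCat.ofHom lineShift)

/-- The exponential on singular simplices. -/
noncomputable def singularExp :
    TopCat.toSSet.obj (TopCat.of ℝ) ⟶ TopCat.toSSet.obj (TopCat.of Circle) :=
  TopCat.toSSet.map (TopCat.ofHom Circle.exp)

theorem singularShift_iterate (n : ℕ) (k : ℕ) (x : (TopCat.toSSet.obj (TopCat.of ℝ)) _⦋n⦌)
    (y : stdSimplex ℝ (Fin (n + 1))) :
    (TopCat.of ℝ).toSSetObjEquiv (.op ⦋n⦌) ((singularShift.app (.op ⦋n⦌))^[k] x) y =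
      (TopCat.of ℝ).toSSetObjEquiv (.op ⦋n⦌) x y + k * (2 * Real.pi) := by
  rw [← lineShift_iterate]
  induction k with
  | zero => rfl
  | succ k ih =>
    rw [Function.iterate_succ_apply', Function.iterate_succ_apply', ← ih]
    rfl

theorem singularShift_comp_singularExp : singularShift ≫ singularExp = singularExp := by
  rw [singularShift, singularExp, ← Functor.map_comp, ← TopCat.ofHom_comp]
  congr 2
  ext1 x
  exact Circle.exp_add_two_pi x

/-- A standard simplex is contractible and locally path connected, so its maps to the circle lift to
`ℝ`; two lifts differ by a constant multiple of `2π`. -/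
theorem line_circle_shortExact :
    (cyclicQuotientSequence singularShift singularExp singularShift_comp_singularExp).ShortExact := by
  refine cyclicQuotientSequence_shortExact _ _ _ (fun n x y h => ?_) (fun n x k hk h => ?_)
    (fun n b => ?_) (fun n x y h => ?_)
  · refine ((TopCat.of ℝ).toSSetObjEquiv (.op ⦋n⦌)).injective (ContinuousMap.ext fun z => ?_)
    have := DFunLike.congr_fun (congrArg ((TopCat.of ℝ).toSSetObjEquiv (.op ⦋n⦌)) h) z
    exact add_right_cancel this
  · obtain ⟨z⟩ : Nonempty (stdSimplex ℝ (Fin (n + 1))) := ⟨_, ite_eq_mem_stdSimplex ℝ 0⟩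
    have h1 := singularShift_iterate n k x z
    rw [h] at h1
    have h2 : (k : ℝ) * (2 * Real.pi) = 0 := by linarith
    have h3 : (0 : ℝ) < k * (2 * Real.pi) :=
      mul_pos (Nat.cast_pos.2 hk) (mul_pos two_pos Real.pi_pos)
    exact h3.ne' h2
  · have := stdSimplex_locallyPathConnectedSpace n
    have := stdSimplex_contractibleSpace n
    let c := (TopCat.of Circle).toSSetObjEquiv (.op ⦋n⦌) b
    let z : stdSimplex ℝ (Fin (n + 1)) := ⟨_, ite_eq_mem_stdSimplex ℝ 0⟩
    obtain ⟨e, he⟩ := Circle.exp_surjective (c z)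
    obtain ⟨F, ⟨-, hF⟩, -⟩ := Circle.isCoveringMap_exp.existsUnique_continuousMap_lifts c z e he
    refine ⟨((TopCat.of ℝ).toSSetObjEquiv (.op ⦋n⦌)).symm F,
      ((TopCat.of Circle).toSSetObjEquiv (.op ⦋n⦌)).injective (ContinuousMap.ext fun w => ?_)⟩
    have h1 := toSSetObjEquiv_map (TopCat.ofHom Circle.exp) (.op ⦋n⦌)
      (((TopCat.of ℝ).toSSetObjEquiv (.op ⦋n⦌)).symm F)
    rw [Equiv.apply_symm_apply] at h1
    exact (DFunLike.congr_fun h1 w).trans (congrFun hF w)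
  · have := stdSimplex_contractibleSpace n
    let z : stdSimplex ℝ (Fin (n + 1)) := ⟨_, ite_eq_mem_stdSimplex ℝ 0⟩
    let c := (TopCat.of ℝ).toSSetObjEquiv (.op ⦋n⦌) x
    let d := (TopCat.of ℝ).toSSetObjEquiv (.op ⦋n⦌) y
    have hcd : ∀ w, Circle.exp (c w) = Circle.exp (d w) := fun w =>
      DFunLike.congr_fun (congrArg ((TopCat.of Circle).toSSetObjEquiv (.op ⦋n⦌)) h) w
    obtain ⟨m, hm⟩ := Circle.exp_eq_exp.1 (hcd z)
    have key : ∀ w, c w = d w + m * (2 * Real.pi) := by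
      refine congrFun (Circle.isCoveringMap_exp.eq_of_comp_eq (g₁ := c)
        (g₂ := fun w => d w + m * (2 * Real.pi)) c.continuous (by fun_prop) (funext fun w => ?_)
        z hm)
      exact (hcd w).trans (Circle.exp_eq_exp.2 ⟨-m, by push_cast; ring⟩)
    -- Only natural iterates of the shift are available, so the sign of `m` decides which simplex is
    -- translated.
    refine ⟨m.natAbs, ?_⟩
    rcases Int.natAbs_eq m with hm' | hm'
    · right
      refine ((TopCat.of ℝ).toSSetObjEquiv (.op ⦋n⦌)).injective (ContinuousMap.ext fun w => ?_)
      rw [singularShift_iterate]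
      refine (key w).trans ?_
      rw [hm', Int.natAbs_natCast]
      rfl
    · left
      refine ((TopCat.of ℝ).toSSetObjEquiv (.op ⦋n⦌)).injective (ContinuousMap.ext fun w => ?_)
      rw [singularShift_iterate]
      have h1 : ((m : ℤ) : ℝ) = -(m.natAbs : ℝ) := by exact_mod_cast hm'
      have := key w
      rw [h1] at this
      change d w = c w + _
      rw [this]; ring

end CoveringHomology

/-! ### Homology of the circle and of the band. -/

section CircleHomology

open CategoryTheory Limits AlgebraicTopology Simplicial

theorem homologyMap_eq_of_homotopic {X Y : Type} [TopologicalSpace X] [TopologicalSpace Y]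
    {f g : C(X, Y)} (h : f.Homotopic g) (n : ℕ) :
    ((singularHomologyFunctor (ModuleCat.{0} ℤ) n).obj (ModuleCat.of ℤ ℤ)).map (TopCat.ofHom f) =
    ((singularHomologyFunctor (ModuleCat.{0} ℤ) n).obj (ModuleCat.of ℤ ℤ)).map (TopCat.ofHom g) :=
  TopCat.Homotopy.congr_homologyMap_singularChainComplexFunctor (f := TopCat.ofHom f)
    (g := TopCat.ofHom g) h.some (ModuleCat.of ℤ ℤ) n

/-- Homotopy equivalent spaces have isomorphic homology. -/
noncomputable def homologyIsoOfHomotopyEquiv {X Y : Type} [TopologicalSpace X] [TopologicalSpace Y]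
    (e : ContinuousMap.HomotopyEquiv X Y) (n : ℕ) : integralHomology n X ≅ integralHomology n Y where
  hom := ((singularHomologyFunctor (ModuleCat.{0} ℤ) n).obj (ModuleCat.of ℤ ℤ)).map
    (TopCat.ofHom e.toFun)
  inv := ((singularHomologyFunctor (ModuleCat.{0} ℤ) n).obj (ModuleCat.of ℤ ℤ)).map
    (TopCat.ofHom e.invFun)
  hom_inv_id := by
    rw [← Functor.map_comp, ← TopCat.ofHom_comp, homologyMap_eq_of_homotopic e.left_inv,
      TopCat.ofHom_id, CategoryTheory.Functor.map_id]
  inv_hom_id := by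
    rw [← Functor.map_comp, ← TopCat.ofHom_comp, homologyMap_eq_of_homotopic e.right_inv,
      TopCat.ofHom_id, CategoryTheory.Functor.map_id]

theorem isZero_integralHomology_of_contractible (X : Type) [TopologicalSpace X]
    [ContractibleSpace X] (n : ℕ) (hn : n ≠ 0) : IsZero (integralHomology n X) :=
  (isZero_singularHomologyFunctor_of_totallyDisconnectedSpace (ModuleCat.{0} ℤ) n
    (ModuleCat.of ℤ ℤ) (TopCat.of Unit) hn).of_iso
    (homologyIsoOfHomotopyEquiv (ContractibleSpace.hequiv_unit X).some n)

/-- The zeroth homology of a path connected space is infinite cyclic. -/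
noncomputable def integralHomologyZeroIso (X : Type) [TopologicalSpace X] [PathConnectedSpace X] :
    integralHomology 0 X ≅ ModuleCat.of ℤ ℤ :=
  have : PathConnectedSpace (TopCat.of X) := ‹PathConnectedSpace X›
  asIso (TopCat.singularHomology₀ε (TopCat.of X) (ModuleCat.of ℤ ℤ))

theorem homologyMap_lineShift_sub_id (n : ℕ) :
    HomologicalComplex.homologyMap (cyclicQuotientSequence singularShift singularExp
      singularShift_comp_singularExp).f n = 0 := by
  have h : lineShift.Homotopic (ContinuousMap.id ℝ) :=
    (Real.homotopicRel_of_eqOn (S := ∅) (Set.eqOn_empty _ _)).homotopic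
  have h1 := homologyMap_eq_of_homotopic h n
  rw [TopCat.ofHom_id, CategoryTheory.Functor.map_id] at h1
  refine (HomologicalComplex.homologyMap_sub _ _ n).trans ?_
  exact sub_eq_zero.2 (h1.trans (HomologicalComplex.homologyMap_id _ n).symm)

/-- The homology of the circle is the homology of the line shifted by one. -/
noncomputable def circleHomologyIso (n : ℕ) :
    integralHomology (n + 1) Circle ≅ integralHomology n ℝ := by
  have hS := line_circle_shortExact
  -- The connecting map is onto because the next map vanishes on homology, and injective because
  -- `H_{n+1}(ℝ) = 0`.
  have h₁ : Epi (hS.δ (n + 1) n rfl) :=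
    (hS.homology_exact₁ (n + 1) n rfl).epi_f (homologyMap_lineShift_sub_id n)
  have h₃ : Mono (hS.δ (n + 1) n rfl) :=
    (hS.homology_exact₃ (n + 1) n rfl).mono_g
      ((isZero_integralHomology_of_contractible ℝ (n + 1) n.succ_ne_zero).eq_of_src _ _)
  have h : IsIso (hS.δ (n + 1) n rfl) := isIso_of_mono_of_epi _
  exact @asIso _ _ _ _ _ h

theorem integralHomology_mobius (n : ℕ) :
    Nonempty (integralHomology n MobiusBand ≃ₗ[ℤ] integralHomology n Circle) :=
  ⟨(homologyIsoOfHomotopyEquiv mobiusHomotopyEquiv n).toLinearEquiv⟩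

theorem integralHomology_zero_circle : Nonempty (integralHomology 0 Circle ≃ₗ[ℤ] ℤ) :=
  ⟨(integralHomologyZeroIso Circle).toLinearEquiv⟩

theorem integralHomology_one_circle : Nonempty (integralHomology 1 Circle ≃ₗ[ℤ] ℤ) :=
  ⟨(circleHomologyIso 0 ≪≫ integralHomologyZeroIso ℝ).toLinearEquiv⟩

theorem integralHomology_circle_subsingleton (n : ℕ) (hn : 2 ≤ n) :
    Subsingleton (integralHomology n Circle) := by
  obtain ⟨m, rfl⟩ := Nat.exists_eq_add_of_le' hn
  exact ModuleCat.subsingleton_of_isZero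
    ((isZero_integralHomology_of_contractible ℝ (m + 1) m.succ_ne_zero).of_iso
      (circleHomologyIso (m + 1)))

end CircleHomology

/-! ### Homotopies from the specialization order. -/

section Specialization

theorem ContinuousMap.HomotopicRel.mono {X Y : Type*} [TopologicalSpace X] [TopologicalSpace Y]
    {f g : C(X, Y)} {S T : Set X} (h : f.HomotopicRel g T) (hST : S ⊆ T) : f.HomotopicRel g S :=
  h.precomp (ContinuousMap.id X) hST

/-- Maps that are comparable in the pointwise specialization order are homotopic relative to the
set where they agree. -/
theorem ContinuousMap.homotopicRel_of_specializes {X Y : Type*} [TopologicalSpace X]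
    [TopologicalSpace Y] {f g : C(X, Y)} {S : Set X} (h : ∀ x, f x ⤳ g x) (hS : Set.EqOn f g S) :
    f.HomotopicRel g S := by
  classical
  -- The homotopy jumps at time `1` only. It is continuous because an open set containing `g x` also
  -- contains `f x`.
  refine ⟨{ toFun := fun z => if z.1 = 1 then g z.2 else f z.2
            continuous_toFun := ?_
            map_zero_left := fun x => if_neg zero_ne_one
            map_one_left := fun x => if_pos rfl
            prop' := fun t x hx => ?_ }⟩
  · refine continuous_def.2 fun U hU => ?_
    have : (fun z : I × X => if z.1 = 1 then g z.2 else f z.2) ⁻¹' U =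
        Prod.snd ⁻¹' (g ⁻¹' U) ∪ (Prod.fst ⁻¹' {1}ᶜ ∩ Prod.snd ⁻¹' (f ⁻¹' U)) := by
      ext ⟨t, x⟩
      have := (h x).mem_open hU
      by_cases ht : t = 1
      · simp [ht]
      · simpa [ht] using this
    rw [this]
    exact ((hU.preimage g.continuous).preimage continuous_snd).union
      ((isOpen_compl_singleton.preimage continuous_fst).inter
        ((hU.preimage f.continuous).preimage continuous_snd))
  · change (if t = 1 then g x else f x) = f x
    rw [hS hx, ite_self]

end Specialization

/-! ### The fence, its weak contractibility, and the map from the circle to the pseudocircle. -/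

section Fence

/-- The infinite fence `⋯ < -2 > -1 < 0 > 1 < 2 > ⋯`. -/
@[ext]
structure Fence : Type where
  /-- The position of a point on the fence. -/
  pos : ℤ

namespace Fence

/-- The odd points are open, and the least neighbourhood of an even point consists of the point
and its two neighbours. -/
instance : TopologicalSpace Fence where
  IsOpen U := ∀ k : ℤ, mk (2 * k) ∈ U → mk (2 * k - 1) ∈ U ∧ mk (2 * k + 1) ∈ U
  isOpen_univ := fun _ _ => ⟨trivial, trivial⟩
  isOpen_inter _ _ hU hV := fun k h =>
    ⟨⟨(hU k h.1).1, (hV k h.2).1⟩, ⟨(hU k h.1).2, (hV k h.2).2⟩⟩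
  isOpen_sUnion _ hS := by
    rintro k ⟨U, hU, h⟩
    exact ⟨⟨U, hU, (hS U hU k h).1⟩, ⟨U, hU, (hS U hU k h).2⟩⟩

theorem isOpen_iff {U : Set Fence} :
    IsOpen U ↔ ∀ k : ℤ, mk (2 * k) ∈ U → mk (2 * k - 1) ∈ U ∧ mk (2 * k + 1) ∈ U := Iff.rfl

theorem specializes_of_odd_even {x y : Fence} (hx : x.pos % 2 = 1) (hxy : |x.pos - y.pos| ≤ 1) :
    x ⤳ y := by
  obtain ⟨x⟩ := x
  obtain ⟨y⟩ := y
  simp only at hx hxy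
  rw [abs_le] at hxy
  refine specializes_iff_forall_open.2 fun U hU hy => ?_
  by_cases h : x = y
  · rwa [h]
  · obtain ⟨k, rfl⟩ : ∃ k, y = 2 * k := ⟨y / 2, by omega⟩
    obtain h' | h' : x = 2 * k - 1 ∨ x = 2 * k + 1 := by omega
    · rw [h']; exact (hU k hy).1
    · rw [h']; exact (hU k hy).2

/-- The retraction of the fence onto the interval of radius `m` about `k`. -/
def clamp (k : ℤ) (m : ℕ) : C(Fence, Fence) where
  toFun x := ⟨max (k - m) (min (k + m) x.pos)⟩
  continuous_toFun := by
    refine continuous_def.2 fun U hU j hj => ?_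
    have key : ∀ a b : ℤ, b % 2 = 0 → |a - b| ≤ 1 →
        mk (max (k - m) (min (k + m) b)) ∈ U → mk (max (k - m) (min (k + m) a)) ∈ U := by
      intro a b hb hab h
      rw [abs_le] at hab
      by_cases he : max (k - m) (min (k + m) a) = max (k - m) (min (k + m) b)
      · rwa [he]
      -- If the clamped values differ, both positions lie in the interval and are unchanged, so an
      -- odd point sits next to an even one.
      · refine (specializes_of_odd_even (x := ⟨_⟩) (y := ⟨_⟩) ?_ ?_).mem_open hU h
        · simp only; omega
        · simp only [abs_le]; omega
    exact ⟨key _ (2 * j) (by omega) (by simp) hj, key _ (2 * j) (by omega) (by simp) hj⟩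

theorem clamp_pos (k : ℤ) (m : ℕ) (x : Fence) :
    (clamp k m x).pos = max (k - m) (min (k + m) x.pos) := rfl

/-- A map from a compact space to the fence is homotopic to a constant, relative to the preimage
of that point. -/
theorem homotopicRel_const {X : Type*} [TopologicalSpace X] [CompactSpace X] (g : C(X, Fence))
    (k : Fence) : g.HomotopicRel (ContinuousMap.const X k) {x | g x = k} := by
  obtain ⟨k⟩ := k
  have step : ∀ m : ℕ, ((clamp k m).comp g).HomotopicRel (ContinuousMap.const X ⟨k⟩)
      {x | g x = ⟨k⟩} := by
    intro m
    induction m with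
    | zero =>
      have : (clamp k 0).comp g = ContinuousMap.const X ⟨k⟩ := by
        ext x
        simp only [ContinuousMap.comp_apply, clamp_pos, ContinuousMap.const_apply]
        omega
      rw [this]
      exact .refl _
    | succ m ih =>
      refine ContinuousMap.HomotopicRel.trans ?_ ih
      have heq : Set.EqOn ((clamp k (m + 1)).comp g) ((clamp k m).comp g) {x | g x = ⟨k⟩} := by
        intro x hx
        have hx : g x = ⟨k⟩ := hx
        ext
        simp only [ContinuousMap.comp_apply, clamp_pos, hx]
        omega
      -- Shrinking the radius by one only moves points at `k ± (m + 1)`. These ends have the same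
      -- parity, so the two maps are comparable, in a direction given by the parity of `k + m`.
      by_cases hk : (k + m) % 2 = 0
      · refine ContinuousMap.homotopicRel_of_specializes (fun x => ?_) heq
        by_cases he : clamp k (m + 1) (g x) = clamp k m (g x)
        · exact specializes_of_eq he
        · rw [Fence.ext_iff, clamp_pos, clamp_pos] at he
          refine specializes_of_odd_even ?_ ?_
          · simp only [ContinuousMap.comp_apply, clamp_pos]; omega
          · simp only [ContinuousMap.comp_apply, clamp_pos, abs_le]; omega
      · refine (ContinuousMap.homotopicRel_of_specializes (fun x => ?_) heq.symm).symm
        by_cases he : clamp k (m + 1) (g x) = clamp k m (g x)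
        · exact specializes_of_eq he.symm
        · rw [Fence.ext_iff, clamp_pos, clamp_pos] at he
          refine specializes_of_odd_even ?_ ?_
          · simp only [ContinuousMap.comp_apply, clamp_pos]; omega
          · simp only [ContinuousMap.comp_apply, clamp_pos, abs_le]; omega
  -- Intervals with odd ends are open and exhaust the fence, so the compact image of `g` lies in one
  -- of them and a large clamp fixes it.
  let V : ℕ → Set Fence := fun n => {y | |y.pos| ≤ 2 * n + 1}
  have hV : ∀ n, IsOpen (V n) := fun n j hj => by
    simp only [V, Set.mem_ofPred_eq, abs_le] at hj ⊢
    omega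
  obtain ⟨n, hn⟩ := isCompact_univ.elim_directed_cover (fun n => g ⁻¹' V n)
    (fun n => (hV n).preimage g.continuous)
    (fun x _ => Set.mem_iUnion.2 ⟨(g x).pos.natAbs, by
      simp only [V, Set.mem_preimage, Set.mem_ofPred_eq, abs_le]; omega⟩)
    (Monotone.directed_le fun a b hab x hx => by
      simp only [V, Set.mem_preimage, Set.mem_ofPred_eq, abs_le] at hx ⊢
      omega)
  have : (clamp k (2 * n + 1 + k.natAbs)).comp g = g := by
    ext x
    have := hn (Set.mem_univ x)
    simp only [V, Set.mem_preimage, Set.mem_ofPred_eq, abs_le] at this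
    simp only [ContinuousMap.comp_apply, clamp_pos]
    omega
  have h := step (2 * n + 1 + k.natAbs)
  rwa [this] at h

theorem genLoop_homotopic_const (n : ℕ) (e : Fence) (Q : Ω^ (Fin n) Fence e) :
    GenLoop.Homotopic Q GenLoop.const :=
  (homotopicRel_const Q.1 e).mono Q.2

instance : PathConnectedSpace Fence where
  nonempty := ⟨⟨0⟩⟩
  joined x y := by
    obtain ⟨H⟩ := homotopicRel_const (ContinuousMap.const Unit x) y
    exact ⟨⟨H.toContinuousMap.comp ⟨fun t => (t, ()), by fun_prop⟩, H.apply_zero _, H.apply_one _⟩⟩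

instance : SimplyConnectedSpace Fence := by
  refine simply_connected_iff_loops_nullhomotopic.2 ⟨inferInstance, fun x γ => ?_⟩
  refine (homotopicRel_const γ.toContinuousMap x).mono ?_
  rintro t (rfl | rfl)
  · exact γ.source
  · exact γ.target

/-- Translation by `4` is the deck action over the four-point pseudocircle; it corresponds to
translation by `2π` on the line. -/
instance : AddAction ℤ Fence where
  vadd n x := ⟨4 * n + x.pos⟩
  zero_vadd x := Fence.ext (by change 4 * 0 + x.pos = x.pos; ring)
  add_vadd m n x := Fence.ext (by
    change 4 * (m + n) + x.pos = 4 * m + (4 * n + x.pos); ring)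

theorem vadd_pos (n : ℤ) (x : Fence) : (n +ᵥ x).pos = 4 * n + x.pos := rfl

/-- The covering of the pseudocircle by the fence. -/
def toPseudocircle (x : Fence) : Pseudocircle :=
  if x.pos % 4 = 0 then .c else if x.pos % 4 = 1 then .a else if x.pos % 4 = 2 then .d else .b

theorem toPseudocircle_eq_iff {x y : Fence} :
    toPseudocircle x = toPseudocircle y ↔ x.pos % 4 = y.pos % 4 := by
  unfold toPseudocircle
  constructor
  · intro h
    split_ifs at h <;> omega
  · intro h
    rw [h]

theorem isAddQuotientCoveringMap_toPseudocircle : IsAddQuotientCoveringMap toPseudocircle ℤ where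
  surjective z := by
    cases z
    exacts [⟨⟨1⟩, rfl⟩, ⟨⟨3⟩, rfl⟩, ⟨⟨0⟩, rfl⟩, ⟨⟨2⟩, rfl⟩]
  isCoinducing := by
    refine ⟨TopologicalSpace.ext_iff.2 fun V => ?_⟩
    rw [isOpen_coinduced, isOpen_iff]
    constructor
    · rintro ⟨hc, hd⟩ k hk
      have hk : toPseudocircle ⟨2 * k⟩ ∈ V := hk
      change toPseudocircle ⟨2 * k - 1⟩ ∈ V ∧ toPseudocircle ⟨2 * k + 1⟩ ∈ V
      have e (i : ℤ) (x : Fence) (h : x.pos % 4 = i % 4) : toPseudocircle x = toPseudocircle ⟨i⟩ :=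
        toPseudocircle_eq_iff.2 h
      rcases Int.emod_two_eq_zero_or_one k with h | h
      · rw [e 0 ⟨2 * k⟩ (by simp only; omega)] at hk
        rw [e 3 ⟨2 * k - 1⟩ (by simp only; omega), e 1 ⟨2 * k + 1⟩ (by simp only; omega)]
        exact (hc hk).symm
      · rw [e 2 ⟨2 * k⟩ (by simp only; omega)] at hk
        rw [e 1 ⟨2 * k - 1⟩ (by simp only; omega), e 3 ⟨2 * k + 1⟩ (by simp only; omega)]
        exact hd hk
    · intro h
      exact ⟨fun hc => (h 0 hc).symm, fun hd => h 1 hd⟩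
  continuous_const_vadd n := by
    refine continuous_def.2 fun U hU k hk => ?_
    have h := hU (2 * n + k) (by
      have : mk (2 * (2 * n + k)) = n +ᵥ mk (2 * k) := Fence.ext (by simp only [vadd_pos]; ring)
      rw [this]; exact hk)
    refine ⟨?_, ?_⟩
    · have : n +ᵥ mk (2 * k - 1) = mk (2 * (2 * n + k) - 1) :=
        Fence.ext (by simp only [vadd_pos]; ring)
      rw [Set.mem_preimage, this]; exact h.1
    · have : n +ᵥ mk (2 * k + 1) = mk (2 * (2 * n + k) + 1) :=
        Fence.ext (by simp only [vadd_pos]; ring)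
      rw [Set.mem_preimage, this]; exact h.2
  apply_eq_iff_mem_orbit {x y} := by
    rw [toPseudocircle_eq_iff, AddAction.mem_orbit_iff]
    constructor
    · intro h
      exact ⟨(x.pos - y.pos) / 4, Fence.ext (by rw [vadd_pos]; omega)⟩
    · rintro ⟨n, rfl⟩
      rw [vadd_pos]
      omega
  disjoint x := by
    -- This is the least neighbourhood of `x`; its positions differ by at most `2`, so translates by
    -- nonzero multiples of `4` miss it.
    refine ⟨{y | y = x ∨ (y.pos % 2 = 1 ∧ |y.pos - x.pos| ≤ 1)}, ?_, fun n => ?_⟩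
    · refine IsOpen.mem_nhds (fun k hk => ?_) (Or.inl rfl)
      rcases hk with rfl | hk
      · exact ⟨Or.inr ⟨by simp only; omega, by simp⟩, Or.inr ⟨by simp only; omega, by simp⟩⟩
      · simp only at hk; omega
    · rintro ⟨_, ⟨y, hy, rfl⟩, hz⟩
      have h1 : ∀ z : Fence, (z = x ∨ (z.pos % 2 = 1 ∧ |z.pos - x.pos| ≤ 1)) →
          |z.pos - x.pos| ≤ 1 := by
        rintro z (rfl | h)
        · simp
        · exact h.2
      have h2 := h1 y hy
      have h3 := h1 _ hz
      simp only [vadd_pos, abs_le] at h2 h3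
      omega

/-- The map from the line to the fence that sends the integer `k` to `2 k` and is constant on the
complementary intervals. -/
noncomputable def ofReal : C(ℝ, Fence) where
  toFun x := ⟨⌊x⌋ + ⌈x⌉⟩
  continuous_toFun := by
    refine continuous_def.2 fun U hU => isOpen_iff_mem_nhds.2 fun x hx => ?_
    have hx : mk (⌊x⌋ + ⌈x⌉) ∈ U := hx
    have hIoo : ∀ (m : ℤ) (y : ℝ), m < y → y < m + 1 → mk (⌊y⌋ + ⌈y⌉) = mk (2 * m + 1) := by
      intro m y h1 h2
      have e1 : ⌊y⌋ = m := Int.floor_eq_iff.2 ⟨h1.le, h2⟩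
      have e2 : ⌈y⌉ = m + 1 := Int.ceil_eq_iff.2 ⟨by push_cast; linarith, by push_cast; exact h2.le⟩
      rw [e1, e2]
      ring_nf
    by_cases h : (⌊x⌋ : ℝ) = x
    · have e2 : ⌈x⌉ = ⌊x⌋ := by
        conv_lhs => rw [← h]
        exact Int.ceil_intCast _
      rw [e2, ← two_mul] at hx
      have h3 := hU _ hx
      have hnb : Set.Ioo ((⌊x⌋ : ℝ) - 1) (⌊x⌋ + 1) ∈ 𝓝 x := Ioo_mem_nhds (by linarith) (by linarith)
      filter_upwards [hnb] with y hy
      change mk (⌊y⌋ + ⌈y⌉) ∈ U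
      rcases lt_trichotomy y ⌊x⌋ with h' | h' | h'
      · rw [hIoo (⌊x⌋ - 1) y (by push_cast; exact hy.1) (by push_cast; linarith)]
        convert h3.1 using 2
        ring
      · rw [h', Int.floor_intCast, Int.ceil_intCast, ← two_mul]
        exact hx
      · rw [hIoo _ y h' hy.2]
        exact h3.2
    · have h1 : (⌊x⌋ : ℝ) < x := lt_of_le_of_ne (Int.floor_le x) h
      have h2 : x < ⌊x⌋ + 1 := Int.lt_floor_add_one x
      filter_upwards [Ioo_mem_nhds h1 h2] with y hy
      change mk (⌊y⌋ + ⌈y⌉) ∈ U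
      rw [hIoo _ y hy.1 hy.2, ← hIoo _ x h1 h2]
      exact hx

/-- The map of the line to the fence that covers the map of the circle to the pseudocircle. -/
noncomputable def ofAngle : C(ℝ, Fence) := ofReal.comp ⟨fun x => x / Real.pi, by fun_prop⟩

/-- Dividing by `π` turns the period `2π` into `2`, and floor plus ceiling doubles it to `4`. -/
theorem ofAngle_add (x : ℝ) (m : ℤ) : ofAngle (x + m * (2 * Real.pi)) = m +ᵥ ofAngle x := by
  have h : (x + m * (2 * Real.pi)) / Real.pi = x / Real.pi + (2 * m : ℤ) := by
    push_cast
    field_simp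
  ext
  rw [vadd_pos]
  change ⌊(x + m * (2 * Real.pi)) / Real.pi⌋ + ⌈(x + m * (2 * Real.pi)) / Real.pi⌉ =
    4 * m + (⌊x / Real.pi⌋ + ⌈x / Real.pi⌉)
  rw [h, Int.floor_add_intCast, Int.ceil_add_intCast]
  ring

/-- The covering of the pseudocircle by the fence, as a bundled continuous map. -/
def projPseudocircle : C(Fence, Pseudocircle) :=
  ⟨toPseudocircle, isAddQuotientCoveringMap_toPseudocircle.continuous⟩

end Fence

theorem isQuotientMap_circleExp : Topology.IsQuotientMap Circle.exp :=
  Circle.isAddQuotientCoveringMap_exp.toIsQuotientMap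

theorem factorsThrough_circleExp :
    Function.FactorsThrough (Fence.projPseudocircle.comp Fence.ofAngle) Circle.exp := by
  intro x y h
  obtain ⟨m, rfl⟩ := Circle.exp_eq_exp.1 h
  simp only [ContinuousMap.comp_apply, Fence.ofAngle_add]
  exact Fence.isAddQuotientCoveringMap_toPseudocircle.map_vadd m

/-- McCord's weak homotopy equivalence from the circle to the pseudocircle. -/
noncomputable def circleToPseudocircle : C(Circle, Pseudocircle) :=
  isQuotientMap_circleExp.lift (Fence.projPseudocircle.comp Fence.ofAngle) factorsThrough_circleExp

theorem circleToPseudocircle_exp (x : ℝ) :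
    circleToPseudocircle (Circle.exp x) = Fence.toPseudocircle (Fence.ofAngle x) :=
  DFunLike.congr_fun (isQuotientMap_circleExp.lift_comp _ factorsThrough_circleExp) x

/-- The lift `ofAngle` is equivariant for free actions of `ℤ` transitive on fibres, hence bijective
on fibres; line and fence have no higher homotopy. -/
theorem isWeakHomotopyEquivalence_circleToPseudocircle :
    IsWeakHomotopyEquivalence circleToPseudocircle := by
  have hcov := Fence.isAddQuotientCoveringMap_toPseudocircle
  refine isWeakHomotopyEquivalence_of_covering Circle.isCoveringMap_exp Circle.exp_surjective
    hcov.isCoveringMap hcov.surjective _ Fence.ofAngle (fun x => (circleToPseudocircle_exp x).symm)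
    (fun b e' h => ?_) (fun e₁ e₂ h h' => ?_) (fun n P Q h => Real.homotopicRel_of_eqOn h)
    Fence.genLoop_homotopic_const
  · obtain ⟨x, rfl⟩ := Circle.exp_surjective b
    rw [circleToPseudocircle_exp] at h
    obtain ⟨m, hm⟩ := hcov.apply_eq_iff_mem_orbit.1 h
    exact ⟨x + m * (2 * Real.pi), Circle.exp_eq_exp.2 ⟨m, rfl⟩, (Fence.ofAngle_add x m).trans hm⟩
  · obtain ⟨m, rfl⟩ := Circle.exp_eq_exp.1 h
    rw [Fence.ofAngle_add] at h'
    have := congrArg Fence.pos h'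
    rw [Fence.vadd_pos] at this
    obtain rfl : m = 0 := by omega
    simp

end Fence

/-! ### Beat points and spaces with at most four points, with `x ⤳ y` read as `x ≤ y`. -/

section FiniteSpaces

theorem continuous_of_forall_specializes {X Y : Type*} [TopologicalSpace X] [TopologicalSpace Y]
    [AlexandrovDiscrete X] {f : X → Y} (h : ∀ x y, x ⤳ y → f x ⤳ f y) : Continuous f :=
  continuous_def.2 fun _ hU => isOpen_iff_forall_specializes.2 fun x y hxy hy =>
    (h x y hxy).mem_open hU hy

/-- Removing a point `x` by moving it to a comparable point `y` (a beat point of Stong) does not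
change the homotopy type. -/
theorem nonempty_homotopyEquiv_compl_singleton {Y : Type*} [TopologicalSpace Y]
    [AlexandrovDiscrete Y] {x y : Y} (hxy : x ≠ y)
    (h : (y ⤳ x ∧ ∀ z, z ≠ x → z ⤳ x → z ⤳ y) ∨ (x ⤳ y ∧ ∀ z, z ≠ x → x ⤳ z → y ⤳ z)) :
    Nonempty (ContinuousMap.HomotopyEquiv Y {z : Y // z ≠ x}) := by
  classical
  let r : Y → {z : Y // z ≠ x} := fun z => if hz : z = x then ⟨y, hxy.symm⟩ else ⟨z, hz⟩
  have r_self : (r x : Y) = y := by simp [r]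
  have r_ne : ∀ z, z ≠ x → (r z : Y) = z := fun z hz => by simp [r, hz]
  have hr : Continuous r := by
    refine continuous_of_forall_specializes fun a b hab => (subtype_specializes_iff _ _).2 ?_
    by_cases ha : a = x <;> by_cases hb : b = x
    · rw [ha, hb]
    · rw [ha, r_self, r_ne b hb]
      rcases h with ⟨h1, -⟩ | ⟨-, h2⟩
      · exact h1.trans (ha ▸ hab)
      · exact h2 b hb (ha ▸ hab)
    · rw [hb, r_self, r_ne a ha]
      rcases h with ⟨-, h2⟩ | ⟨h1, -⟩
      · exact h2 a ha (hb ▸ hab)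
      · exact Specializes.trans (hb ▸ hab) h1
    · rwa [r_ne a ha, r_ne b hb]
  let i : C({z : Y // z ≠ x}, Y) := ⟨Subtype.val, continuous_subtype_val⟩
  refine ⟨⟨⟨r, hr⟩, i, ?_, ?_⟩⟩
  · rcases h with ⟨h1, -⟩ | ⟨h1, -⟩
    · refine (ContinuousMap.homotopicRel_of_specializes (S := ∅) (fun z => ?_)
        (Set.eqOn_empty _ _)).homotopic
      by_cases hz : z = x
      · subst hz
        change (r z : Y) ⤳ z
        rw [r_self]; exact h1
      · exact specializes_of_eq (r_ne z hz)
    · refine (ContinuousMap.homotopicRel_of_specializes (S := ∅) (fun z => ?_)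
        (Set.eqOn_empty _ _)).homotopic.symm
      by_cases hz : z = x
      · subst hz
        change z ⤳ (r z : Y)
        rw [r_self]; exact h1
      · exact specializes_of_eq (r_ne z hz).symm
  · have : (ContinuousMap.comp ⟨r, hr⟩ i) = ContinuousMap.id _ := by
      ext z
      exact r_ne z.1 z.2
    rw [this]

/-- The points of the pseudocircle. -/
def pseudocircleEquivFin : Pseudocircle ≃ Fin 4 where
  toFun | .a => 0 | .b => 1 | .c => 2 | .d => 3
  invFun := ![.a, .b, .c, .d]
  left_inv z := by cases z <;> rfl
  right_inv i := by fin_cases i <;> rfl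

instance : Finite Pseudocircle := Finite.of_equiv _ pseudocircleEquivFin.symm

theorem natCard_pseudocircle : Nat.card Pseudocircle = 4 := by
  rw [Nat.card_congr pseudocircleEquivFin, Nat.card_eq_fintype_card, Fintype.card_fin]

/-- A connected space with more than one and at most four points and without beat points is the
pseudocircle. -/
theorem nonempty_homeomorph_pseudocircle_of_no_beat {Y : Type*} [TopologicalSpace Y] [Finite Y]
    [PreconnectedSpace Y] (hcard : Nat.card Y ≤ 4) (hY : ¬ Subsingleton Y)
    (down : ∀ x y : Y, x ≠ y → y ⤳ x → ∃ z, z ≠ x ∧ z ⤳ x ∧ ¬ z ⤳ y)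
    (up : ∀ x y : Y, x ≠ y → x ⤳ y → ∃ z, z ≠ x ∧ x ⤳ z ∧ ¬ y ⤳ z) :
    Nonempty (Y ≃ₜ Pseudocircle) := by
  have antisymm : ∀ x y : Y, x ⤳ y → y ⤳ x → x = y := by
    intro x y hxy hyx
    by_contra hne
    obtain ⟨z, -, hzx, hzy⟩ := down x y hne hyx
    exact hzy (hzx.trans hxy)
  obtain ⟨c, a₀, hac₀, hne₀⟩ : ∃ c a : Y, a ⤳ c ∧ a ≠ c := by
    by_contra hcon
    push Not at hcon
    have : DiscreteTopology Y := discreteTopology_iff_forall_isOpen.2 fun s =>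
      isOpen_iff_forall_specializes.2 fun x y hxy hy => by rwa [hcon y x hxy]
    exact hY (PreconnectedSpace.trivial_of_discrete)
  -- Among the points strictly below `c`, one with the largest down-set is covered by `c`.
  obtain ⟨a, ⟨hac, hne⟩, hmax⟩ := Set.Finite.exists_maximalFor
    (fun a : Y => Set.ncard {z | z ⤳ a}) {a | a ⤳ c ∧ a ≠ c} (Set.toFinite _) ⟨a₀, hac₀, hne₀⟩
  have cover : ∀ b, a ⤳ b → b ⤳ c → b ≠ c → b = a := by
    intro b hab hbc hbne
    have hsub : {z | z ⤳ a} ⊆ {z | z ⤳ b} := fun z hz => Specializes.trans hz hab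
    have hle := hmax (j := b) ⟨hbc, hbne⟩ (Set.ncard_le_ncard hsub)
    have heq := Set.eq_of_subset_of_ncard_le hsub hle
    have : b ∈ {z | z ⤳ a} := heq ▸ specializes_rfl
    exact antisymm b a this hab
  -- As `c` cannot be moved down to `a`, another point `b` lies below `c`; as `a` cannot be moved up
  -- to `c`, another point `d` lies above `a`. By cardinality nothing else exists.
  obtain ⟨b, hbc', hbc, hba⟩ := down c a hne.symm hac
  obtain ⟨d, hda', had, hcd⟩ := up a c hne hac
  have hab' : a ≠ b := by rintro rfl; exact hba specializes_rfl
  have hcd' : c ≠ d := by rintro rfl; exact hcd specializes_rfl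
  have hab : ¬ a ⤳ b := fun h => hab' (cover b h hbc hbc').symm
  have hdc : ¬ d ⤳ c := fun h => hda' (cover d had h hcd'.symm)
  have hbd' : b ≠ d := by rintro rfl; exact hab had
  have hca : ¬ c ⤳ a := fun h => hne (antisymm a c hac h)
  have hcb : ¬ c ⤳ b := fun h => hbc' (antisymm b c hbc h)
  have hda : ¬ d ⤳ a := fun h => hda' (antisymm d a h had)
  have hdb : ¬ d ⤳ b := fun h => hab (had.trans h)
  let e : Pseudocircle → Y := fun | .a => a | .b => b | .c => c | .d => d
  have hinj : Function.Injective e := by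
    rintro (_ | _ | _ | _) (_ | _ | _ | _) h <;> first | rfl | exact absurd h ‹_› |
      exact absurd h.symm ‹_›
  have hbij := hinj.bijective_of_nat_card_le (by rwa [natCard_pseudocircle])
  have hbd : b ⤳ d := by
    -- Since `d` is not a beat point, some point below it is not below `a`; only `b` qualifies.
    obtain ⟨z, hz, hzd, hza⟩ := down d a hda' had
    obtain ⟨w, rfl⟩ := hbij.2 z
    cases w
    · exact absurd specializes_rfl hza
    · exact hzd
    · exact absurd hzd hcd
    · exact absurd rfl hz
  refine ⟨((Equiv.ofBijective e hbij).toHomeomorph fun s => ?_).symm⟩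
  constructor
  · rintro ⟨hc, hd⟩
    refine isOpen_iff_forall_specializes.2 fun x y hxy hy => ?_
    obtain ⟨x, rfl⟩ := hbij.2 x
    obtain ⟨y, rfl⟩ := hbij.2 y
    rcases x with _ | _ | _ | _ <;> rcases y with _ | _ | _ | _ <;>
      first | exact hy | exact absurd hxy ‹_› | exact (hc hy).1 | exact (hc hy).2 |
        exact (hd hy).1 | exact (hd hy).2
  · intro hs
    exact ⟨fun h => ⟨hac.mem_open hs h, hbc.mem_open hs h⟩,
      fun h => ⟨had.mem_open hs h, hbd.mem_open hs h⟩⟩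

/-- A path connected space with at most four points is contractible or the pseudocircle. -/
theorem contractible_or_homeomorph_pseudocircle (n : ℕ) (Y : Type) [TopologicalSpace Y] [Finite Y]
    [PathConnectedSpace Y] (hn : Nat.card Y = n) (hcard : n ≤ 4) :
    ContractibleSpace Y ∨ Nonempty (Y ≃ₜ Pseudocircle) := by
  induction n generalizing Y with
  | zero =>
    exact absurd hn (Nat.card_pos (α := Y)).ne'
  | succ n ih =>
    by_cases hbeat : ∃ x y : Y, x ≠ y ∧
      ((y ⤳ x ∧ ∀ z, z ≠ x → z ⤳ x → z ⤳ y) ∨ (x ⤳ y ∧ ∀ z, z ≠ x → x ⤳ z → y ⤳ z))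
    · obtain ⟨x, y, hxy, h⟩ := hbeat
      obtain ⟨e⟩ := nonempty_homotopyEquiv_compl_singleton hxy h
      have hcard' : Nat.card {z : Y // z ≠ x} = n := by
        have h1 := Set.ncard_add_ncard_compl ({x} : Set Y)
        rw [Set.ncard_singleton, hn] at h1
        have h2 : Nat.card {z : Y // z ≠ x} = ({x}ᶜ : Set Y).ncard := rfl
        omega
      have : PathConnectedSpace {z : Y // z ≠ x} := by
        refine pathConnectedSpace_iff_zerothHomotopy.2 ⟨⟨.mk ⟨y, hxy.symm⟩⟩, ⟨?_⟩⟩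
        rintro ⟨u⟩ ⟨v⟩
        obtain ⟨H⟩ := e.right_inv
        have h1 : ∀ w, Joined (e.toFun (e.invFun w)) w := fun w =>
          ⟨⟨H.toContinuousMap.comp ⟨fun t => (t, w), by fun_prop⟩, H.apply_zero w, H.apply_one w⟩⟩
        exact Quotient.sound ((h1 u).symm.trans
          (((PathConnectedSpace.joined _ _).map e.toFun.continuous).trans (h1 v)))
      -- After a removal at most three points remain, too few for the pseudocircle.
      rcases ih {z : Y // z ≠ x} hcard' (by omega) with h' | ⟨⟨f⟩⟩
      · exact Or.inl e.contractibleSpace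
      · have := Nat.card_congr f.toEquiv
        rw [natCard_pseudocircle] at this
        omega
    · by_cases hY : Subsingleton Y
      · exact Or.inl inferInstance
      · refine Or.inr (nonempty_homeomorph_pseudocircle_of_no_beat (hn ▸ hcard) hY
          (fun x y hxy h => ?_) (fun x y hxy h => ?_))
        · by_contra hcon
          push Not at hcon
          exact hbeat ⟨x, y, hxy, Or.inl ⟨h, hcon⟩⟩
        · by_contra hcon
          push Not at hcon
          exact hbeat ⟨x, y, hxy, Or.inr ⟨h, hcon⟩⟩

end FiniteSpaces

/-! ### A weak homotopy invariant: path connected but not simply connected. -/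

section Invariance

universe u

theorem simplyConnectedSpace_iff_subsingleton_pi_one {X : Type*} [TopologicalSpace X]
    [PathConnectedSpace X] (x : X) : SimplyConnectedSpace X ↔ Subsingleton (π_ 1 X x) := by
  constructor
  · intro h
    exact HomotopyGroup.pi1EquivFundamentalGroup.subsingleton
  · intro h
    refine simply_connected_iff_loops_nullhomotopic.2 ⟨inferInstance, fun y γ => ?_⟩
    have h1 : Subsingleton (FundamentalGroup X x) :=
      HomotopyGroup.pi1EquivFundamentalGroup.symm.subsingleton
    have h2 : Subsingleton (FundamentalGroup X y) :=
      (FundamentalGroup.fundamentalGroupMulEquivOfPathConnected y x).toEquiv.subsingleton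
    exact Quotient.exact (h2.elim (Quotient.mk _ γ) (Quotient.mk _ (Path.refl y)))

theorem IsWeakHomotopyEquivalence.pathConnectedSpace_iff {X Y : Type u} [TopologicalSpace X]
    [TopologicalSpace Y] {f : C(X, Y)} (hf : IsWeakHomotopyEquivalence f) :
    PathConnectedSpace X ↔ PathConnectedSpace Y := by
  let e := Equiv.ofBijective _ hf.1
  rw [pathConnectedSpace_iff_zerothHomotopy, pathConnectedSpace_iff_zerothHomotopy,
    e.nonempty_congr, e.subsingleton_congr]

/-- This property separates models of the circle from contractible spaces. Path connectedness is
included so that a single base point decides whether the fundamental group is trivial. -/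
theorem IsWeakHomotopyEquivalence.pathConnected_not_simplyConnected_iff {X Y : Type u}
    [TopologicalSpace X] [TopologicalSpace Y] {f : C(X, Y)} (hf : IsWeakHomotopyEquivalence f) :
    (PathConnectedSpace X ∧ ¬ SimplyConnectedSpace X) ↔
      (PathConnectedSpace Y ∧ ¬ SimplyConnectedSpace Y) := by
  have key : PathConnectedSpace X → PathConnectedSpace Y →
      (SimplyConnectedSpace X ↔ SimplyConnectedSpace Y) := by
    intro hX hY
    obtain ⟨x⟩ := hX.nonempty
    rw [simplyConnectedSpace_iff_subsingleton_pi_one x,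
      simplyConnectedSpace_iff_subsingleton_pi_one (f x)]
    exact (Equiv.ofBijective _ (hf.2 0 x)).subsingleton_congr
  have h := hf.pathConnectedSpace_iff
  constructor
  · rintro ⟨h1, h2⟩
    exact ⟨h.1 h1, fun h3 => h2 ((key h1 (h.1 h1)).2 h3)⟩
  · rintro ⟨h1, h2⟩
    exact ⟨h.2 h1, fun h3 => h2 ((key (h.2 h1) h1).1 h3)⟩

theorem WeaklyHomotopyEquivalent.pathConnected_not_simplyConnected_iff {X Y : Type u}
    [TopologicalSpace X] [TopologicalSpace Y] (h : WeaklyHomotopyEquivalent X Y) :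
    (PathConnectedSpace X ∧ ¬ SimplyConnectedSpace X) ↔
      (PathConnectedSpace Y ∧ ¬ SimplyConnectedSpace Y) := by
  have key : ∀ A B : TopCat.{u}, Relation.EqvGen
      (fun A B : TopCat.{u} => ∃ f : C(A, B), IsWeakHomotopyEquivalence f) A B →
      ((PathConnectedSpace A ∧ ¬ SimplyConnectedSpace A) ↔
        (PathConnectedSpace B ∧ ¬ SimplyConnectedSpace B)) := by
    intro A B hAB
    induction hAB with
    | rel A B hf =>
      obtain ⟨f, hf⟩ := hf
      exact hf.pathConnected_not_simplyConnected_iff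
    | refl A => exact Iff.rfl
    | symm A B _ ih => exact ih.symm
    | trans A B C _ _ ih₁ ih₂ => exact ih₁.trans ih₂
  exact key _ _ h

theorem IsWeakHomotopyEquivalence.weaklyHomotopyEquivalent {X Y : Type u} [TopologicalSpace X]
    [TopologicalSpace Y] {f : C(X, Y)} (hf : IsWeakHomotopyEquivalence f) :
    WeaklyHomotopyEquivalent X Y :=
  .rel (TopCat.of X) (TopCat.of Y) ⟨f, hf⟩

theorem WeaklyHomotopyEquivalent.symm {X Y : Type u} [TopologicalSpace X] [TopologicalSpace Y]
    (h : WeaklyHomotopyEquivalent X Y) : WeaklyHomotopyEquivalent Y X :=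
  Relation.EqvGen.symm _ _ h

theorem WeaklyHomotopyEquivalent.trans {X Y Z : Type u} [TopologicalSpace X] [TopologicalSpace Y]
    [TopologicalSpace Z] (h : WeaklyHomotopyEquivalent X Y) (h' : WeaklyHomotopyEquivalent Y Z) :
    WeaklyHomotopyEquivalent X Z :=
  Relation.EqvGen.trans _ _ _ h h'

theorem Homeomorph.isWeakHomotopyEquivalence {X Y : Type u} [TopologicalSpace X]
    [TopologicalSpace Y] [PathConnectedSpace Y] (e : X ≃ₜ Y) :
    IsWeakHomotopyEquivalence (e : C(X, Y)) := by
  have : PathConnectedSpace X := e.symm.surjective.pathConnectedSpace e.symm.continuous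
  refine isWeakHomotopyEquivalence_of_pointed _ fun x => ⟨(e.symm : C(Y, X)), ?_, ?_, ?_⟩
  · exact e.symm_apply_apply x
  · have : (e : C(X, Y)).comp (e.symm : C(Y, X)) = ContinuousMap.id Y := by
      ext y; exact e.apply_symm_apply y
    rw [this]
    exact .refl _
  · have : (e.symm : C(Y, X)).comp (e : C(X, Y)) = ContinuousMap.id X := by
      ext y; exact e.symm_apply_apply y
    rw [this]
    exact .refl _

end Invariance

/-! ### Homotopy groups of the circle and the band. -/

section HomotopyGroups

/-- The integers as the group of periods of the exponential of the circle. -/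
noncomputable def intEquivPeriods : ℤ ≃+ AddSubgroup.zmultiples (2 * Real.pi) :=
  AddEquiv.ofBijective
    ((zmultiplesHom ℝ (2 * Real.pi)).codRestrict (AddSubgroup.zmultiples (2 * Real.pi))
      fun n => ⟨n, rfl⟩)
    ⟨fun m n h => by
      have h' : m • (2 * Real.pi) = n • (2 * Real.pi) := congrArg Subtype.val h
      rw [zsmul_eq_mul, zsmul_eq_mul] at h'
      exact_mod_cast mul_right_cancel₀ (mul_ne_zero two_ne_zero Real.pi_ne_zero) h',
    fun ⟨_, n, h⟩ => ⟨n, Subtype.ext h⟩⟩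

/-- The fundamental group of the circle is infinite cyclic. -/
theorem nonempty_pi_one_circle (z : Circle) : Nonempty (π_ 1 Circle z ≃* Multiplicative ℤ) := by
  obtain ⟨x, hx⟩ := Circle.exp_surjective z
  -- The covering identifies the fundamental group with the opposite of the group of periods, which
  -- is commutative.
  exact ⟨HomotopyGroup.pi1MulEquivFundamentalGroup.trans
    ((Circle.isAddQuotientCoveringMap_exp.fundamentalGroupEquiv ⟨x, hx⟩).trans
      (MulOpposite.opMulEquiv.symm.trans (AddEquiv.toMultiplicative intEquivPeriods.symm)))⟩

/-- In these degrees loops lift to loops in `ℝ`, where straight lines contract them relative to the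
boundary. -/
theorem subsingleton_pi_circle (n : ℕ) (hn : 2 ≤ n) (z : Circle) :
    Subsingleton (π_ n Circle z) := by
  obtain ⟨m, rfl⟩ := Nat.exists_eq_add_of_le' hn
  obtain ⟨x, rfl⟩ := Circle.exp_surjective z
  have key : ∀ q : Ω^ (Fin (m + 2)) Circle (Circle.exp x), GenLoop.Homotopic q GenLoop.const := by
    intro q
    obtain ⟨Q, hQ⟩ := Circle.isCoveringMap_exp.exists_genLoop_lift q x rfl
    have h : Q.1.HomotopicRel GenLoop.const.1 (Cube.boundary _) :=
      Real.homotopicRel_of_eqOn fun y hy => Q.2 y hy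
    have h' := h.comp_continuousMap Circle.exp
    have c : Circle.exp.comp Q.1 = q.1 := ContinuousMap.ext hQ
    rw [c] at h'
    exact h'
  refine ⟨?_⟩
  rintro ⟨p⟩ ⟨q⟩
  exact Quotient.sound ((key p).trans (key q).symm)

theorem nonempty_pi_one_mobius (x : MobiusBand) (z : Circle) :
    Nonempty (π_ 1 MobiusBand x ≃* π_ 1 Circle z) := by
  obtain ⟨e⟩ := nonempty_pi_one_circle (mobiusProj x)
  obtain ⟨e'⟩ := nonempty_pi_one_circle z
  exact ⟨(MulEquiv.ofBijective _ (isWeakHomotopyEquivalence_mobiusProj.2 0 x)).trans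
    (e.trans e'.symm)⟩

theorem subsingleton_pi_mobius (n : ℕ) (hn : 2 ≤ n) (x : MobiusBand) :
    Subsingleton (π_ n MobiusBand x) := by
  have := subsingleton_pi_circle n hn (mobiusProj x)
  obtain ⟨m, rfl⟩ := Nat.exists_eq_add_of_le' (one_le_two.trans hn)
  exact (isWeakHomotopyEquivalence_mobiusProj.2 m x).1.subsingleton

theorem not_simplyConnectedSpace_circle : ¬ SimplyConnectedSpace Circle := by
  rw [simplyConnectedSpace_iff_subsingleton_pi_one (1 : Circle)]
  intro h
  obtain ⟨e⟩ := nonempty_pi_one_circle 1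
  have := e.symm.toEquiv.subsingleton
  exact not_subsingleton (Multiplicative ℤ) this

end HomotopyGroups

/-! ### Minimal finite models. -/

section MinimalModels

theorem isMinimalFiniteModel_iff_of_weaklyHomotopyEquivalent {X : Type} [TopologicalSpace X]
    (hX : WeaklyHomotopyEquivalent Circle X) (Y : Type) [TopologicalSpace Y] :
    IsMinimalFiniteModel Y X ↔ Nonempty (Y ≃ₜ Pseudocircle) := by
  have hP : WeaklyHomotopyEquivalent Pseudocircle X :=
    isWeakHomotopyEquivalence_circleToPseudocircle.weaklyHomotopyEquivalent.symm.trans hX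
  have hPc : PathConnectedSpace Pseudocircle :=
    isWeakHomotopyEquivalence_circleToPseudocircle.pathConnectedSpace_iff.1 inferInstance
  have hXinv := hX.pathConnected_not_simplyConnected_iff.1
    ⟨inferInstance, not_simplyConnectedSpace_circle⟩
  have small : ∀ (Z : Type) [TopologicalSpace Z], IsFiniteModel Z X → Nat.card Z ≤ 4 →
      Nonempty (Z ≃ₜ Pseudocircle) := by
    intro Z _ ⟨hfin, hZ⟩ hcard
    obtain ⟨hpc, hsc⟩ := hZ.pathConnected_not_simplyConnected_iff.2 hXinv
    exact (contractible_or_homeomorph_pseudocircle _ Z rfl hcard).resolve_left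
      fun _ => hsc inferInstance
  constructor
  · rintro ⟨hY, hmin⟩
    refine small Y hY ?_
    rw [← natCard_pseudocircle]
    exact hmin Pseudocircle ⟨inferInstance, hP⟩
  · rintro ⟨e⟩
    refine ⟨⟨Finite.of_equiv _ e.symm.toEquiv,
      e.isWeakHomotopyEquivalence.weaklyHomotopyEquivalent.trans hP⟩, fun Z _ hZ => ?_⟩
    rw [Nat.card_congr e.toEquiv, natCard_pseudocircle]
    by_contra hlt
    -- A model with fewer than four points would be homeomorphic to the pseudocircle, which has
    -- four.
    obtain ⟨f⟩ := small Z hZ (by omega)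
    rw [Nat.card_congr f.toEquiv, natCard_pseudocircle] at hlt
    exact hlt le_rfl

end MinimalModels

theorem mainTheorem1 :
    -- the band deformation retracts onto its central circle, which is a circle, so M ≃ S¹
    DeformationRetractsOnto MobiusBand centralCircle ∧
    Nonempty (centralCircle ≃ₜ Circle) ∧
    Nonempty (ContinuousMap.HomotopyEquiv MobiusBand Circle) ∧
    -- homotopy groups, at all base points
    (∀ (x : MobiusBand) (z : Circle),
      Nonempty (π_ 1 MobiusBand x ≃* π_ 1 Circle z) ∧
      Nonempty (π_ 1 Circle z ≃* Multiplicative ℤ)) ∧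
    (∀ (n : ℕ), 2 ≤ n → ∀ x : MobiusBand, Subsingleton (π_ n MobiusBand x)) ∧
    -- integral homology groups
    (∀ n : ℕ, Nonempty (integralHomology n MobiusBand ≃ₗ[ℤ] integralHomology n Circle)) ∧
    Nonempty (integralHomology 0 Circle ≃ₗ[ℤ] ℤ) ∧
    Nonempty (integralHomology 1 Circle ≃ₗ[ℤ] ℤ) ∧
    (∀ n : ℕ, 2 ≤ n → Subsingleton (integralHomology n Circle)) ∧
    -- minimal finite models: those of M are those of S¹, namely the four-point pseudocircle,
    -- which is unique up to homeomorphism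
    (∀ (Y : Type) [TopologicalSpace Y],
      IsMinimalFiniteModel Y MobiusBand ↔ IsMinimalFiniteModel Y Circle) ∧
    Nat.card Pseudocircle = 4 ∧
    (∀ (Y : Type) [TopologicalSpace Y],
      IsMinimalFiniteModel Y MobiusBand ↔ Nonempty (Y ≃ₜ Pseudocircle)) := by
  have hM := isMinimalFiniteModel_iff_of_weaklyHomotopyEquivalent
    isWeakHomotopyEquivalence_mobiusProj.weaklyHomotopyEquivalent.symm
  have hC := isMinimalFiniteModel_iff_of_weaklyHomotopyEquivalent
    (.refl (TopCat.of Circle) : WeaklyHomotopyEquivalent Circle Circle)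
  exact ⟨deformationRetractsOnto_centralCircle, nonempty_centralCircle_homeomorph,
    ⟨mobiusHomotopyEquiv⟩, fun x z => ⟨nonempty_pi_one_mobius x z, nonempty_pi_one_circle z⟩,
    subsingleton_pi_mobius, integralHomology_mobius, integralHomology_zero_circle,
    integralHomology_one_circle, integralHomology_circle_subsingleton,
    fun Y _ => (hM Y).trans (hC Y).symm, natCard_pseudocircle, fun Y _ => hM Y⟩
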